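/- **Definitions.** For $\alpha>0$, let $\widehat L_n^{(\alpha)}$ ($n\ge 1$) be the $X_1$-Laguerre polynomials, i.e. the polynomials obtained (up to nonzero constant factors) by Gram--Schmidt orthogonalization of $x+\alpha+1,\ (x+\alpha)^2,\ (x+\alpha)^3,\dots$ with respect to $$\langle P,Q\rangle_\alpha=\int_0^\infty P(x)Q(x)\,\frac{e^{-x}x^\alpha}{(x+\alpha)^2}\,dx .$$ For $0<\alpha<\beta$, put $a=\tfrac12(\beta-\alpha)$, $b=\frac{\beta+\alpha}{\beta-\alpha}$, $c=b+\frac1a$, and let $\widehat P_n^{(\alpha,\beta)}$ ($n\ge 1$) be the $X_1$-Jacobi polynomials, i.e. the polynomials obtained (up to nonzero constant factors) by Gram--Schmidt orthogonalization of $x-c,\ (x-b)^2,\ (x-b)^3,\dots$ with respect to $$\langle P,Q\rangle_{\alpha,\beta}=\int_{-1}^1 P(x)Q(x)\,\frac{(1-x)^\alpha(1+x)^\beta}{(x-b)^2}\,dx .$$ Let $H_n$ be the (physicists') Hermite polynomial of degree $n$, orthogonal with respect to $e^{-x^2}$ on $\mathbb R$. **Theorem.** For $n\ge1$ and $0<\alpha<\beta$,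 the polynomials $\widehat L_n^{(\alpha)}$, $\widehat P_n^{(\alpha,\beta)}$ and, for $n\ge 2$, $H_{n-1}$ have degrees $n$, $n$ and $n-1$, and all their zeros are real and simple. Denote the zeros in increasing order by $\widehat x_{n,k}^{(\alpha)}$ and $\widehat x_{n,k}^{(\alpha,\beta)}$ ($1\le k\le n$) and $h_{n-1,k}$ ($1\le k\le n-1$), respectively. Then, for every fixed $\alpha>0$ and fixed integers $1\le k\le n$, $$\lim_{\beta\to\infty}\frac{\beta\bigl(1-\widehat x_{n,k}^{(\alpha,\beta)}\bigr)}{2}=\widehat x_{n,\,n+1-k}^{(\alpha)},$$ and, for fixed integers $2\le k\le n$, $$\lim_{\alpha\to\infty}\frac{\widehat x_{n,k}^{(\alpha)}-\alpha}{\sqrt{2\alpha}}=h_{n-1,k-1}.$$ -/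

import Mathlib

open Filter Topology Polynomial

/-- Gram–Schmidt orthogonalization (without normalization) of the sequence `u 0, u 1, …` of real
polynomials with respect to the form `B`. -/
noncomputable def gramSchmidtPoly (B : ℝ[X] → ℝ[X] → ℝ) (u : ℕ → ℝ[X]) (m : ℕ) : ℝ[X] :=
  u m - ∑ i : Fin m,
    (B (gramSchmidtPoly B u i) (u m) /
      B (gramSchmidtPoly B u i) (gramSchmidtPoly B u i)) • gramSchmidtPoly B u i
termination_by m
decreasing_by all_goals exact i.2

/-- The inner product of the `X₁`-Laguerre family, with weight `e⁻ˣ x^α / (x + α)²` on `(0, ∞)`. -/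
noncomputable def laguerreInner (α : ℝ) (P Q : ℝ[X]) : ℝ :=
  ∫ x in Set.Ioi (0 : ℝ), P.eval x * Q.eval x * (Real.exp (-x) * x ^ α / (x + α) ^ 2)

/-- The sequence `x + α + 1, (x + α)², (x + α)³, …`. -/
noncomputable def laguerreSeq (α : ℝ) : ℕ → ℝ[X]
  | 0 => X + C (α + 1)
  | j + 1 => (X + C α) ^ (j + 2)

/-- The `X₁`-Laguerre polynomial of degree `n`, for `n ≥ 1` and up to a nonzero constant factor:
the `n`-th polynomial of the Gram–Schmidt process. -/
noncomputable def x1Laguerre (α : ℝ) (n : ℕ) : ℝ[X] :=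
  gramSchmidtPoly (laguerreInner α) (laguerreSeq α) (n - 1)

/-- `a = (β - α) / 2`. -/
noncomputable def jacobiA (α β : ℝ) : ℝ := (β - α) / 2

/-- `b = (β + α) / (β - α)`. -/
noncomputable def jacobiB (α β : ℝ) : ℝ := (β + α) / (β - α)

/-- `c = b + 1 / a`. -/
noncomputable def jacobiC (α β : ℝ) : ℝ := jacobiB α β + 1 / jacobiA α β

/-- The inner product of the `X₁`-Jacobi family, with weight
`(1 - x)^α (1 + x)^β / (x - b)²` on `(-1, 1)`. -/
noncomputable def jacobiInner (α β : ℝ) (P Q : ℝ[X]) : ℝ :=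
  ∫ x in Set.Ioo (-1 : ℝ) 1,
    P.eval x * Q.eval x * ((1 - x) ^ α * (1 + x) ^ β / (x - jacobiB α β) ^ 2)

/-- The sequence `x - c, (x - b)², (x - b)³, …`. -/
noncomputable def jacobiSeq (α β : ℝ) : ℕ → ℝ[X]
  | 0 => X - C (jacobiC α β)
  | j + 1 => (X - C (jacobiB α β)) ^ (j + 2)

/-- The `X₁`-Jacobi polynomial of degree `n`, for `n ≥ 1` and up to a nonzero constant factor:
the `n`-th polynomial of the Gram–Schmidt process. -/
noncomputable def x1Jacobi (α β : ℝ) (n : ℕ) : ℝ[X] :=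
  gramSchmidtPoly (jacobiInner α β) (jacobiSeq α β) (n - 1)

/-- The (physicists') Hermite polynomial `Hₙ(x) = 2^{n/2} Heₙ(√2 x)`, orthogonal with respect to
`e^{-x²}`; Mathlib's `Polynomial.hermite n` is the probabilists' polynomial `Heₙ`. -/
noncomputable def physHermite (n : ℕ) : ℝ[X] :=
  C (√2 ^ n) * ((Polynomial.hermite n).map (Int.castRingHom ℝ)).comp (C √2 * X)

/-- The `k`-th zero (`k = 1, 2, …`) of `p` in increasing order; it is meaningful for
`1 ≤ k ≤ p.roots.card`. -/
noncomputable def orderedZero (p : ℝ[X]) (k : ℕ) : ℝ :=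
  (p.roots.sort (· ≤ ·)).getD (k - 1) 0

/-- `p` has degree exactly `n`, and it has `n` distinct real zeros (so all its zeros are real
and simple). -/
def HasSimpleRealZeros (p : ℝ[X]) (n : ℕ) : Prop :=
  p.natDegree = n ∧ p.roots.Nodup ∧ p.roots.card = n

/-! ### Gram–Schmidt, orthogonality and uniqueness -/

section GramSchmidt

/-! After an affine change of variable, both exceptional families are Gram–Schmidt sequences in a
space of codimension one, the polynomials with `κ P'(-η) = P(-η)`, for a positive weight on an
interval to the right of `-η`. The `n`-th member is characterized up to scale: it has degree `n` and
is orthogonal to every element of lower degree of that space (`IsOrthogonalIn.eq_smul`), so the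
basis may be chosen freely.

Zeros (`IsOrthogonalIn.zeros_robinSubmodule`): multiply `P` by the linear factors of its sign
changes in the interval. This test product `q` need not lie in the space, but `q (X - r)` does for
exactly one `r`, and that `r` is less than `-η`, so the extra factor has constant sign on the
interval. Hence a polynomial of degree `m + 1` has at least `m` zeros in the interval, and the same
computation places the remaining one to the left of `-η`.

Limits: if moments and starting sequences converge, so do the Gram–Schmidt polynomials
(`polyTendsto_gramSchmidtPoly`), and simple zeros of the limit attract zeros
(`tendsto_zeros_of_eval`). For Jacobi to Laguerre put `t = β (1 - x) / 2`: the weight contains `(1 -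
t/β)^β → e^{-t}`, while `η → α` and `κ → 1`.

For Laguerre to Hermite put `x = α + N s` with `N = √(2α)`: the weight tends to `e^{-s²}`, but `η =
N` and `κ = 1/N`, so the given basis diverges. The basis `s^j (1 + c s)` of the same space, with `c
→ 0`, converges to the monomials. The degree drops by one in the limit; the lost zero is the
exceptional one, below `-α`, which accounts for the index shift. -/

theorem gramSchmidtPoly_eq (B : ℝ[X] → ℝ[X] → ℝ) (u : ℕ → ℝ[X]) (m : ℕ) :
    gramSchmidtPoly B u m = u m - ∑ i ∈ Finset.range m,
      (B (gramSchmidtPoly B u i) (u m) /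
        B (gramSchmidtPoly B u i) (gramSchmidtPoly B u i)) • gramSchmidtPoly B u i := by
  rw [gramSchmidtPoly, Finset.sum_range]

/-- The symmetric bilinear form `(P, Q) ↦ L (P Q)` of a linear functional `L`. -/
noncomputable def functionalForm (L : ℝ[X] →ₗ[ℝ] ℝ) (P Q : ℝ[X]) : ℝ := L (P * Q)

variable (L : ℝ[X] →ₗ[ℝ] ℝ) (u : ℕ → ℝ[X])

theorem gramSchmidtPoly_mem (B : ℝ[X] → ℝ[X] → ℝ) (W : Submodule ℝ ℝ[X]) (hW : ∀ j, u j ∈ W)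
    (m : ℕ) : gramSchmidtPoly B u m ∈ W := by
  induction m using Nat.strong_induction_on with
  | _ m ih =>
    rw [gramSchmidtPoly_eq]
    exact W.sub_mem (hW m) (W.sum_mem fun i hi => W.smul_mem _ (ih i (Finset.mem_range.1 hi)))

/-- The offset `d` is the degree of the first vector: 1 for the exceptional families, 0 for the
monomials. -/
theorem gramSchmidtPoly_degree_lt (B : ℝ[X] → ℝ[X] → ℝ) (d : ℕ)
    (hd : ∀ j, (u j).degree < (j + d + 1 : ℕ)) (m : ℕ) :
    (gramSchmidtPoly B u m).degree < (m + d + 1 : ℕ) := by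
  induction m using Nat.strong_induction_on with
  | _ m ih =>
    rw [gramSchmidtPoly_eq, ← mem_degreeLT]
    refine Submodule.sub_mem _ (mem_degreeLT.2 (hd m)) (Submodule.sum_mem _ fun i hi =>
      Submodule.smul_mem _ _ (mem_degreeLT.2 ((ih i (Finset.mem_range.1 hi)).trans_le ?_)))
    have := Finset.mem_range.1 hi
    exact_mod_cast (by omega : i + d + 1 ≤ m + d + 1)

theorem gramSchmidtPoly_coeff (B : ℝ[X] → ℝ[X] → ℝ) (d : ℕ)
    (hd : ∀ j, (u j).degree < (j + d + 1 : ℕ)) (m : ℕ) :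
    (gramSchmidtPoly B u m).coeff (m + d) = (u m).coeff (m + d) := by
  rw [gramSchmidtPoly_eq, coeff_sub, finsetSum_coeff, Finset.sum_eq_zero, sub_zero]
  intro i hi
  have := Finset.mem_range.1 hi
  rw [coeff_smul, coeff_eq_zero_of_degree_lt, smul_zero]
  refine (gramSchmidtPoly_degree_lt u B d hd i).trans_le ?_
  exact_mod_cast (by omega : i + d + 1 ≤ m + d)

theorem gramSchmidtPoly_orthogonal (m : ℕ)
    (hm : ∀ i < m, L (gramSchmidtPoly (functionalForm L) u i *
      gramSchmidtPoly (functionalForm L) u i) ≠ 0) :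
    ∀ i < m, L (gramSchmidtPoly (functionalForm L) u m *
      gramSchmidtPoly (functionalForm L) u i) = 0 := by
  induction m using Nat.strong_induction_on with
  | _ m ih =>
    intro i hi
    rw [gramSchmidtPoly_eq _ _ m, sub_mul, map_sub, Finset.sum_mul, map_sum,
      Finset.sum_eq_single i]
    · simp only [functionalForm, smul_mul_assoc, map_smul, smul_eq_mul]
      rw [div_mul_cancel₀ _ (hm i hi), mul_comm, sub_self]
    · intro j hj hji
      have hj := Finset.mem_range.1 hj
      rw [smul_mul_assoc, map_smul]
      rcases lt_or_gt_of_ne hji with h | h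
      · rw [mul_comm, ih i hi (fun k hk => hm k (hk.trans hi)) j h, smul_zero]
      · rw [ih j hj (fun k hk => hm k (hk.trans hj)) i h, smul_zero]
    · intro h
      exact absurd (Finset.mem_range.2 hi) h

/-- A polynomial of `W` of degree at most `m + d` orthogonal to all elements of `W` of degree
less than `m + d`. -/
def IsOrthogonalIn (W : Submodule ℝ ℝ[X]) (n : ℕ) (P : ℝ[X]) : Prop :=
  P ∈ W ∧ P.degree < (n + 1 : ℕ) ∧ ∀ Q ∈ W, Q.degree < n → L (P * Q) = 0

variable {L u}

/-- Subtracting a multiple of the `j`-th Gram–Schmidt polynomial lowers the degree of a test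
polynomial without leaving `W`. The descent ends at degree below `d`, where `hW0` leaves only 0; no
separate proof that `u` spans `W` is needed. -/
theorem isOrthogonalIn_gramSchmidtPoly {W : Submodule ℝ ℝ[X]} {d : ℕ}
    (hpos : ∀ P : ℝ[X], P ≠ 0 → 0 < L (P * P)) (hW : ∀ j, u j ∈ W)
    (hW0 : ∀ Q ∈ W, Q.degree < d → Q = 0) (hd : ∀ j, (u j).degree < (j + d + 1 : ℕ))
    (hc : ∀ j, (u j).coeff (j + d) ≠ 0) (m : ℕ) :
    IsOrthogonalIn L W (m + d) (gramSchmidtPoly (functionalForm L) u m) := by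
  set g := gramSchmidtPoly (functionalForm L) u with hg
  have hgc : ∀ j, (g j).coeff (j + d) ≠ 0 := fun j => by
    rw [hg, gramSchmidtPoly_coeff u _ d hd]; exact hc j
  have hg0 : ∀ j, g j ≠ 0 := fun j h => hgc j (by rw [h, coeff_zero])
  refine ⟨gramSchmidtPoly_mem u _ W hW m, gramSchmidtPoly_degree_lt u _ d hd m, ?_⟩
  suffices h : ∀ j ≤ m, ∀ Q ∈ W, Q.degree < (j + d : ℕ) → L (g m * Q) = 0 from
    h m le_rfl
  intro j
  induction j with
  | zero =>
    intro _ Q hQ hQd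
    rw [hW0 Q hQ (by simpa using hQd), mul_zero, map_zero]
  | succ j ih =>
    intro hj Q hQ hQd
    set t := Q.coeff (j + d) / (g j).coeff (j + d) with ht
    have h1 : L (g m * (Q - t • g j)) = 0 := by
      refine ih (by omega) _ (W.sub_mem hQ (W.smul_mem _ (gramSchmidtPoly_mem u _ W hW j))) ?_
      have h2 : (Q - t • g j).degree < (j + d + 1 : ℕ) := by
        rw [← mem_degreeLT]
        refine Submodule.sub_mem _ (mem_degreeLT.2 ?_) (Submodule.smul_mem _ _
          (mem_degreeLT.2 (gramSchmidtPoly_degree_lt u _ d hd j)))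
        rwa [show j + d + 1 = j + 1 + d by ring]
      rw [degree_lt_iff_coeff_zero] at h2 ⊢
      intro k hk
      rcases hk.eq_or_lt with rfl | hk
      · rw [coeff_sub, coeff_smul, smul_eq_mul, ht, div_mul_cancel₀ _ (hgc j), sub_self]
      · exact h2 k (by omega)
    rw [mul_sub, map_sub, mul_smul_comm, map_smul,
      gramSchmidtPoly_orthogonal L u m (fun i _ => (hpos _ (hg0 i)).ne') j (by omega),
      smul_zero, sub_zero] at h1
    exact h1

/-- The difference of the two sides lies in `W` with degree less than `n`, so it is orthogonal to
itself. This is what permits a change of basis. -/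
theorem IsOrthogonalIn.eq_smul {W : Submodule ℝ ℝ[X]} {n : ℕ} {P Q : ℝ[X]}
    (hpos : ∀ P : ℝ[X], P ≠ 0 → 0 < L (P * P))
    (hP : IsOrthogonalIn L W n P) (hQ : IsOrthogonalIn L W n Q) (hc : Q.coeff n ≠ 0) :
    P = (P.coeff n / Q.coeff n) • Q := by
  set t := P.coeff n / Q.coeff n with ht
  by_contra hne
  have hD : P - t • Q ∈ W := W.sub_mem hP.1 (W.smul_mem _ hQ.1)
  have h2 : (P - t • Q).degree < (n + 1 : ℕ) := by
    rw [← mem_degreeLT]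
    exact Submodule.sub_mem _ (mem_degreeLT.2 hP.2.1) (Submodule.smul_mem _ _
      (mem_degreeLT.2 hQ.2.1))
  have h3 : (P - t • Q).degree < n := by
    rw [degree_lt_iff_coeff_zero] at h2 ⊢
    intro k hk
    rcases hk.eq_or_lt with rfl | hk
    · rw [coeff_sub, coeff_smul, smul_eq_mul, ht, div_mul_cancel₀ _ hc, sub_self]
    · exact h2 k (by omega)
  have h4 := hpos (P - t • Q) (sub_ne_zero.2 hne)
  rw [sub_mul, map_sub, smul_mul_assoc, map_smul, hP.2.2 _ hD h3, hQ.2.2 _ hD h3] at h4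
  simp at h4

/-- The projection coefficients are quotients of values of the form, so `K` cancels and the scalars
`c j` factor out. -/
theorem gramSchmidtPoly_comp {B B' : ℝ[X] → ℝ[X] → ℝ} {v : ℕ → ℝ[X]} {c : ℕ → ℝ} {K : ℝ}
    {A : ℝ[X]} (hK : K ≠ 0) (hc : ∀ j, c j ≠ 0)
    (hB : ∀ P Q, B' P Q = K * B (P.comp A) (Q.comp A))
    (hBs : ∀ (s t : ℝ) (P Q : ℝ[X]), B (s • P) (t • Q) = s * t * B P Q)
    (hv : ∀ j, (v j).comp A = c j • u j) (m : ℕ) :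
    (gramSchmidtPoly B' v m).comp A = c m • gramSchmidtPoly B u m := by
  induction m using Nat.strong_induction_on with
  | _ m ih =>
    rw [gramSchmidtPoly_eq, gramSchmidtPoly_eq B, sub_comp, hv, smul_sub, Finset.smul_sum,
      Polynomial.sum_comp]
    congr 1
    refine Finset.sum_congr rfl fun i hi => ?_
    have hi := Finset.mem_range.1 hi
    rw [smul_comp, hB, hB, ih i hi, hv, hBs, hBs, smul_smul, smul_smul]
    congr 1
    have := hc i
    -- In the degenerate case both quotients are 0, since division by zero gives 0; hence no
    -- definiteness is assumed.
    by_cases h0 : B (gramSchmidtPoly B u i) (gramSchmidtPoly B u i) = 0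
    · simp [h0]
    · field_simp

theorem functionalForm_smul_smul (s t : ℝ) (P Q : ℝ[X]) :
    functionalForm L (s • P) (t • Q) = s * t * functionalForm L P Q := by
  simp only [functionalForm, smul_mul_smul_comm, map_smul, smul_eq_mul]

end GramSchmidt

/-! ### Coefficientwise convergence of polynomials -/

section Convergence

variable {ι : Type*} {l : Filter ι}

/-- Coefficientwise convergence of polynomials of bounded degree. -/
def PolyTendsto (p : ι → ℝ[X]) (l : Filter ι) (q : ℝ[X]) : Prop :=
  (∃ D, (∀ i, (p i).natDegree ≤ D) ∧ q.natDegree ≤ D) ∧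
    ∀ k, Tendsto (fun i => (p i).coeff k) l (𝓝 (q.coeff k))

/-- The common degree bound turns everything into a sum over one fixed finite range, so convergence
of moments suffices. -/
theorem PolyTendsto.map {p : ι → ℝ[X]} {q : ℝ[X]} (h : PolyTendsto p l q)
    {F : ι → ℝ[X] →ₗ[ℝ] ℝ} {G : ℝ[X] →ₗ[ℝ] ℝ}
    (hF : ∀ k, Tendsto (fun i => F i (X ^ k)) l (𝓝 (G (X ^ k)))) :
    Tendsto (fun i => F i (p i)) l (𝓝 (G q)) := by
  obtain ⟨⟨D, hD, hq⟩, hc⟩ := h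
  have key : ∀ (F : ℝ[X] →ₗ[ℝ] ℝ) (p : ℝ[X]), p.natDegree ≤ D →
      F p = ∑ k ∈ Finset.range (D + 1), p.coeff k * F (X ^ k) := by
    intro F p hp
    conv_lhs => rw [p.as_sum_range' (D + 1) (by omega)]
    rw [map_sum]
    refine Finset.sum_congr rfl fun k _ => ?_
    rw [← C_mul_X_pow_eq_monomial, ← smul_eq_C_mul, map_smul, smul_eq_mul]
  rw [key G q hq]
  simp only [fun i => key (F i) (p i) (hD i)]
  exact tendsto_finsetSum _ fun k _ => (hc k).mul (hF k)

theorem PolyTendsto.eval {p : ι → ℝ[X]} {q : ℝ[X]} (h : PolyTendsto p l q) (x : ℝ) :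
    Tendsto (fun i => (p i).eval x) l (𝓝 (q.eval x)) :=
  h.map (F := fun _ => leval x) (G := leval x) fun _ => tendsto_const_nhds

theorem PolyTendsto.mul {p p' : ι → ℝ[X]} {q q' : ℝ[X]} (h : PolyTendsto p l q)
    (h' : PolyTendsto p' l q') : PolyTendsto (fun i => p i * p' i) l (q * q') := by
  obtain ⟨⟨D, hD, hq⟩, hc⟩ := h
  obtain ⟨⟨D', hD', hq'⟩, hc'⟩ := h'
  refine ⟨⟨D + D', fun i => natDegree_mul_le_of_le (hD i) (hD' i),
    natDegree_mul_le_of_le hq hq'⟩, fun k => ?_⟩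
  simp only [coeff_mul]
  exact tendsto_finsetSum _ fun x _ => (hc _).mul (hc' _)

theorem PolyTendsto.sub {p p' : ι → ℝ[X]} {q q' : ℝ[X]} (h : PolyTendsto p l q)
    (h' : PolyTendsto p' l q') : PolyTendsto (fun i => p i - p' i) l (q - q') := by
  obtain ⟨⟨D, hD, hq⟩, hc⟩ := h
  obtain ⟨⟨D', hD', hq'⟩, hc'⟩ := h'
  refine ⟨⟨max D D', fun i => (natDegree_sub_le _ _).trans (max_le_max (hD i) (hD' i)),
    (natDegree_sub_le _ _).trans (max_le_max hq hq')⟩, fun k => ?_⟩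
  simp only [coeff_sub]
  exact (hc _).sub (hc' _)

theorem PolyTendsto.add {p p' : ι → ℝ[X]} {q q' : ℝ[X]} (h : PolyTendsto p l q)
    (h' : PolyTendsto p' l q') : PolyTendsto (fun i => p i + p' i) l (q + q') := by
  obtain ⟨⟨D, hD, hq⟩, hc⟩ := h
  obtain ⟨⟨D', hD', hq'⟩, hc'⟩ := h'
  refine ⟨⟨max D D', fun i => (natDegree_add_le _ _).trans (max_le_max (hD i) (hD' i)),
    (natDegree_add_le _ _).trans (max_le_max hq hq')⟩, fun k => ?_⟩
  simp only [coeff_add]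
  exact (hc _).add (hc' _)

theorem PolyTendsto.smul {p : ι → ℝ[X]} {q : ℝ[X]} {s : ι → ℝ} {t : ℝ} (hs : Tendsto s l (𝓝 t))
    (h : PolyTendsto p l q) : PolyTendsto (fun i => s i • p i) l (t • q) := by
  obtain ⟨⟨D, hD, hq⟩, hc⟩ := h
  refine ⟨⟨D, fun i => (natDegree_smul_le _ _).trans (hD i),
    (natDegree_smul_le _ _).trans hq⟩, fun k => ?_⟩
  simp only [coeff_smul, smul_eq_mul]
  exact hs.mul (hc _)

theorem polyTendsto_const (q : ℝ[X]) : PolyTendsto (fun _ : ι => q) l q :=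
  ⟨⟨_, fun _ => le_rfl, le_rfl⟩, fun _ => tendsto_const_nhds⟩

theorem PolyTendsto.sum {σ : Type*} {s : Finset σ} {p : σ → ι → ℝ[X]} {q : σ → ℝ[X]}
    (h : ∀ j ∈ s, PolyTendsto (p j) l (q j)) :
    PolyTendsto (fun i => ∑ j ∈ s, p j i) l (∑ j ∈ s, q j) := by
  classical
  induction s using Finset.induction_on with
  | empty => simpa using polyTendsto_const 0
  | insert a s ha ih =>
    simp only [Finset.sum_insert ha]
    exact (h a (by simp)).add (ih fun j hj => h j (by simp [hj]))

theorem PolyTendsto.pow {p : ι → ℝ[X]} {q : ℝ[X]} (h : PolyTendsto p l q) (n : ℕ) :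
    PolyTendsto (fun i => p i ^ n) l (q ^ n) := by
  induction n with
  | zero => simpa using polyTendsto_const 1
  | succ n ih => simpa only [pow_succ] using ih.mul h

theorem polyTendsto_C {s : ι → ℝ} {t : ℝ} (hs : Tendsto s l (𝓝 t)) :
    PolyTendsto (fun i => C (s i)) l (C t) := by
  simpa [smul_eq_C_mul] using (polyTendsto_const (ι := ι) (l := l) 1).smul hs

/-- The recursion is continuous wherever the limiting squared norms do not vanish. Degrees are
allowed to drop in the limit, as happens in the Hermite case. -/
theorem polyTendsto_gramSchmidtPoly {F : ι → ℝ[X] →ₗ[ℝ] ℝ} {G : ℝ[X] →ₗ[ℝ] ℝ}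
    {u : ι → ℕ → ℝ[X]} {v : ℕ → ℝ[X]}
    (hF : ∀ k, Tendsto (fun i => F i (X ^ k)) l (𝓝 (G (X ^ k))))
    (hu : ∀ j, PolyTendsto (fun i => u i j) l (v j))
    (hG : ∀ j, G (gramSchmidtPoly (functionalForm G) v j *
      gramSchmidtPoly (functionalForm G) v j) ≠ 0) (m : ℕ) :
    PolyTendsto (fun i => gramSchmidtPoly (functionalForm (F i)) (u i) m) l
      (gramSchmidtPoly (functionalForm G) v m) := by
  induction m using Nat.strong_induction_on with
  | _ m ih =>
    rw [gramSchmidtPoly_eq]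
    simp only [fun i => gramSchmidtPoly_eq (functionalForm (F i)) (u i) m]
    refine (hu m).sub (PolyTendsto.sum fun j hj => ?_)
    have hj := ih j (Finset.mem_range.1 hj)
    exact hj.smul (((hj.mul (hu m)).map hF).div ((hj.mul hj).map hF) (hG j))

end Convergence

/-! ### Reality, simplicity and stability of zeros -/

section Zeros

theorem natDegree_le_of_degree_lt_succ {P : ℝ[X]} {n : ℕ} (h : P.degree < (n + 1 : ℕ)) :
    P.natDegree ≤ n :=
  natDegree_le_iff_coeff_eq_zero.2 fun k hk => (degree_lt_iff_coeff_zero P (n + 1)).1 h k hk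

/-- `T` collects the zeros of odd multiplicity in `S`: splitting off one factor at a time toggles
the membership of its zero. A polynomial without zeros in `S` has constant sign there by the
intermediate value theorem. -/
theorem exists_finset_roots_sign {S : Set ℝ} (hS : S.OrdConnected) (P : ℝ[X]) (hP : P ≠ 0) :
    ∃ T : Finset ℝ, (∀ t ∈ T, t ∈ S ∧ P.IsRoot t) ∧ ∃ ε : ℝ, ε ≠ 0 ∧
      ∀ x ∈ S, 0 ≤ ε * (P * ∏ t ∈ T, (X - C t)).eval x := by
  classical
  induction h : P.natDegree generalizing P with
  | zero =>
    rw [natDegree_eq_zero] at h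
    obtain ⟨a, rfl⟩ := h
    refine ⟨∅, by simp, a, by simpa using hP, fun x _ => ?_⟩
    simpa using mul_self_nonneg a
  | succ n ih =>
    by_cases hr : ∃ t ∈ S, P.IsRoot t
    · obtain ⟨t, ht, hPt⟩ := hr
      obtain ⟨R, rfl⟩ := dvd_iff_isRoot.2 hPt
      have hR : R ≠ 0 := right_ne_zero_of_mul hP
      have hdeg : R.natDegree = n := by
        rw [natDegree_mul (X_sub_C_ne_zero t) hR, natDegree_X_sub_C] at h
        omega
      obtain ⟨T, hT, ε, hε, hs⟩ := ih R hR hdeg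
      by_cases htT : t ∈ T
      · refine ⟨T.erase t, fun s hs' => ?_, ε, hε, fun x hx => ?_⟩
        · have := hT s (Finset.mem_of_mem_erase hs')
          exact ⟨this.1, this.2.dvd (dvd_mul_left _ _)⟩
        · rw [mul_comm (X - C t), mul_assoc, Finset.mul_prod_erase T (fun t => X - C t) htT]
          exact hs x hx
      · refine ⟨insert t T, fun s hs' => ?_, ε, hε, fun x hx => ?_⟩
        · rcases Finset.mem_insert.1 hs' with rfl | hs'
          · exact ⟨ht, hPt⟩
          · have := hT s hs'
            exact ⟨this.1, this.2.dvd (dvd_mul_left _ _)⟩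
        · rw [Finset.prod_insert htT]
          have := mul_nonneg (hs x hx) (mul_self_nonneg (x - t))
          refine this.trans_eq ?_
          simp only [eval_mul, eval_sub, eval_X, eval_C]
          ring
    · push Not at hr
      have hc : ContinuousOn (fun x => P.eval x) S := P.continuous.continuousOn
      by_cases hpos : ∃ y ∈ S, 0 < P.eval y
      · obtain ⟨y, hy, hy0⟩ := hpos
        refine ⟨∅, by simp, 1, one_ne_zero, fun x hx => ?_⟩
        by_contra! hneg
        obtain ⟨w, hw, hw0⟩ := hS.isPreconnected.intermediate_value hx hy hc
          (show (0 : ℝ) ∈ Set.Icc _ _ from ⟨by simpa using hneg.le, hy0.le⟩)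
        exact hr w hw hw0
      · push Not at hpos
        exact ⟨∅, by simp, -1, by simp, fun x hx => by simpa using hpos x hx⟩

theorem prod_X_sub_C_dvd {T : Finset ℝ} {P : ℝ[X]} (hT : ∀ t ∈ T, P.IsRoot t) :
    ∏ t ∈ T, (X - C t) ∣ P :=
  Finset.prod_dvd_of_coprime
    (fun _ _ _ _ hij => (pairwise_coprime_X_sub_C Function.injective_id hij))
    fun t ht => dvd_iff_isRoot.2 (hT t ht)

theorem degree_finset_prod_X_sub_C (T : Finset ℝ) :
    (∏ t ∈ T, (X - C t) : ℝ[X]).degree = (T.card : ℕ) := by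
  simp [degree_prod]

theorem monic_finset_prod_X_sub_C (T : Finset ℝ) : (∏ t ∈ T, (X - C t)).Monic :=
  monic_prod_of_monic _ _ fun t _ => monic_X_sub_C t

theorem IsOrthogonalIn.zeros_top {L : ℝ[X] →ₗ[ℝ] ℝ} {S : Set ℝ} (hS : S.OrdConnected)
    (hL : ∀ P : ℝ[X], P ≠ 0 → (∀ x ∈ S, 0 ≤ P.eval x) → 0 < L P) {n : ℕ} {P : ℝ[X]}
    (hP : IsOrthogonalIn L ⊤ n P) (hc : P.coeff n ≠ 0) :
    ∃ z : Fin n → ℝ, StrictMono z ∧ ∀ i, P.IsRoot (z i) := by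
  have hP0 : P ≠ 0 := fun h => hc (by rw [h, coeff_zero])
  obtain ⟨T, hT, ε, hε, hs⟩ := exists_finset_roots_sign hS P hP0
  have hcard : n ≤ T.card := by
    by_contra! hlt
    have h0 := hP.2.2 (∏ t ∈ T, (X - C t)) Submodule.mem_top
      (by rw [degree_finset_prod_X_sub_C]; exact_mod_cast hlt)
    have h1 := hL (ε • (P * ∏ t ∈ T, (X - C t)))
      (smul_ne_zero hε (mul_ne_zero hP0 (monic_finset_prod_X_sub_C T).ne_zero))
      (fun x hx => by simpa only [eval_smul, smul_eq_mul] using hs x hx)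
    rw [map_smul, h0, smul_zero] at h1
    exact lt_irrefl _ h1
  obtain ⟨T', hT', hcard'⟩ := Finset.exists_subset_card_eq hcard
  exact ⟨T'.orderEmbOfFin hcard', (T'.orderEmbOfFin hcard').strictMono, fun i =>
    (hT _ (hT' (T'.orderEmbOfFin_mem hcard' i))).2⟩

/-- The polynomials `P` with `κ P'(-η) = P(-η)`. -/
noncomputable def robinSubmodule (η κ : ℝ) : Submodule ℝ ℝ[X] where
  carrier := {P | κ * (derivative P).eval (-η) = P.eval (-η)}
  add_mem' := by
    intro P Q hP hQ
    simp only [Set.mem_ofPred_eq] at *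
    simp only [derivative_add, eval_add, mul_add, hP, hQ]
  zero_mem' := by simp
  smul_mem' := by
    intro c P hP
    simp only [Set.mem_ofPred_eq] at *
    simp only [derivative_smul, eval_smul, smul_eq_mul, ← hP]
    ring

theorem mem_robinSubmodule {η κ : ℝ} {P : ℝ[X]} :
    P ∈ robinSubmodule η κ ↔ κ * (derivative P).eval (-η) = P.eval (-η) := Iff.rfl

/-- The condition forces a constant to vanish, so the space starts in degree 1. -/
theorem eq_zero_of_mem_robinSubmodule {η κ : ℝ} {P : ℝ[X]} (hP : P ∈ robinSubmodule η κ)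
    (hd : P.degree < (1 : ℕ)) : P = 0 := by
  have : P.natDegree = 0 := Nat.le_zero.1 (natDegree_le_of_degree_lt_succ hd)
  obtain ⟨a, rfl⟩ := natDegree_eq_zero.1 this
  rw [mem_robinSubmodule] at hP
  simp at hP
  simp [← hP]

/-- The logarithmic derivative of the product at `-η` is `-∑ 1 / (η + t)`; `σ` is this sum without
the sign. -/
theorem exists_logDeriv_nonneg {η : ℝ} (T : Finset ℝ) (hT : ∀ t ∈ T, -η < t) :
    ∃ σ : ℝ, 0 ≤ σ ∧ (∏ t ∈ T, (X - C t)).eval (-η) ≠ 0 ∧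
      (derivative (∏ t ∈ T, (X - C t))).eval (-η) = -σ * (∏ t ∈ T, (X - C t)).eval (-η) := by
  classical
  induction T using Finset.induction_on with
  | empty => exact ⟨0, le_rfl, by simp, by simp⟩
  | insert a T ha ih =>
    obtain ⟨σ, hσ, h0, hd⟩ := ih fun t ht => hT t (Finset.mem_insert_of_mem ht)
    have haη : 0 < η + a := by have := hT a (Finset.mem_insert_self a T); linarith
    refine ⟨σ + 1 / (η + a), by positivity, ?_, ?_⟩
    · rw [Finset.prod_insert ha, eval_mul]
      refine mul_ne_zero ?_ h0
      simp only [eval_sub, eval_X, eval_C]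
      linarith
    · rw [Finset.prod_insert ha, derivative_mul, eval_add, eval_mul, eval_mul, hd, eval_mul]
      simp
      field_simp
      ring

/-- After division by `q (-η)` the boundary condition is one linear equation in `r`. Its solution is
less than `-η` because `κ > 0` and `σ ≥ 0`. -/
theorem mul_X_sub_C_mem_robinSubmodule_iff {η κ σ r : ℝ} {q : ℝ[X]} (hκ : 0 < κ) (hσ : 0 ≤ σ)
    (hq : q.eval (-η) ≠ 0) (hq' : (derivative q).eval (-η) = -σ * q.eval (-η)) :
    q * (X - C r) ∈ robinSubmodule η κ ↔ r = -η - κ / (1 + κ * σ) := by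
  have h1 : 0 < 1 + κ * σ := by positivity
  rw [mem_robinSubmodule]
  simp only [derivative_mul, eval_add, eval_mul, hq', derivative_sub, derivative_X, derivative_C,
    eval_sub, eval_X, eval_C, sub_zero, mul_one]
  constructor
  · intro h
    have : q.eval (-η) * (κ - (-η - r) * (1 + κ * σ)) = 0 := by linear_combination h
    have := (mul_eq_zero.1 this).resolve_left hq
    field_simp
    linarith
  · rintro rfl
    field_simp
    ring

theorem strictMono_fin_cons {n : ℕ} {f : Fin n → ℝ} (hf : StrictMono f) {r : ℝ}
    (hr : ∀ i, r < f i) : StrictMono (Fin.cons r f : Fin (n + 1) → ℝ) := by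
  intro i j
  refine Fin.cases ?_ (fun i => ?_) i <;> refine Fin.cases ?_ (fun j => ?_) j
  · simp
  · intro _; simpa using hr j
  · intro h; exact absurd h (by simp)
  · intro h; simpa using hf (Fin.succ_lt_succ_iff.1 h)

theorem IsOrthogonalIn.zeros_robinSubmodule {L : ℝ[X] →ₗ[ℝ] ℝ} {S : Set ℝ} {η κ : ℝ}
    (hS : S.OrdConnected) (hη : ∀ x ∈ S, -η < x) (hκ : 0 < κ)
    (hL : ∀ P : ℝ[X], P ≠ 0 → (∀ x ∈ S, 0 ≤ P.eval x) → 0 < L P) {m : ℕ} {P : ℝ[X]}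
    (hP : IsOrthogonalIn L (robinSubmodule η κ) (m + 1) P) (hc : P.coeff (m + 1) ≠ 0) :
    ∃ z : Fin (m + 1) → ℝ, StrictMono z ∧ (∀ i, P.IsRoot (z i)) ∧ z 0 < -η := by
  have hP0 : P ≠ 0 := fun h => hc (by rw [h, coeff_zero])
  obtain ⟨T, hT, ε, hε, hs⟩ := exists_finset_roots_sign hS P hP0
  -- With fewer than `m` sign changes, the product corrected by `X - r` is an admissible test
  -- polynomial of degree at most `m`, and it makes the integrand of constant sign.
  have hcard : m ≤ T.card := by
    by_contra! hlt
    obtain ⟨σ, hσ, hq, hq'⟩ := exists_logDeriv_nonneg T fun t ht => hη t (hT t ht).1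
    have hmem := (mul_X_sub_C_mem_robinSubmodule_iff hκ hσ hq hq').2 rfl
    set r := -η - κ / (1 + κ * σ) with hr
    have hrη : r < -η := by have : 0 < κ / (1 + κ * σ) := by positivity
                            linarith
    have h0 := hP.2.2 _ hmem (by
      rw [degree_mul, degree_finset_prod_X_sub_C, degree_X_sub_C]; exact_mod_cast (by omega))
    have h1 := hL (ε • (P * ((∏ t ∈ T, (X - C t)) * (X - C r))))
      (smul_ne_zero hε (mul_ne_zero hP0
        (mul_ne_zero (monic_finset_prod_X_sub_C T).ne_zero (X_sub_C_ne_zero r))))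
      (fun x hx => by
        have h2 := mul_nonneg (hs x hx) (by have := hη x hx; linarith : 0 ≤ x - r)
        refine h2.trans_eq ?_
        simp only [eval_smul, eval_mul, eval_sub, eval_X, eval_C, smul_eq_mul]
        ring)
    rw [map_smul, h0, smul_zero] at h1
    exact lt_irrefl _ h1
  obtain ⟨T', hT', hcard'⟩ := Finset.exists_subset_card_eq hcard
  -- Once `m` zeros in `S` are divided out a linear factor remains; since `P` satisfies the boundary
  -- condition, its zero must be the `r` found above.
  obtain ⟨R, hR⟩ := prod_X_sub_C_dvd (T := T') fun t ht => (hT t (hT' ht)).2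
  obtain ⟨σ, hσ, hq, hq'⟩ := exists_logDeriv_nonneg T' fun t ht => hη t (hT t (hT' ht)).1
  have hR0 : R ≠ 0 := fun h => hP0 (by rw [hR, h, mul_zero])
  have hPdeg : P.degree = (m + 1 : ℕ) := by
    exact le_antisymm (natDegree_le_iff_degree_le.1 (natDegree_le_of_degree_lt_succ hP.2.1))
      (le_degree_of_ne_zero hc)
  have hRdeg : R.degree = 1 := by
    have h1 := hPdeg
    rw [hR, degree_mul, degree_finset_prod_X_sub_C, hcard', degree_eq_natDegree hR0] at h1
    rw [degree_eq_natDegree hR0]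
    norm_cast at h1 ⊢
    omega
  obtain ⟨r, hr⟩ := exists_root_of_degree_eq_one hRdeg
  obtain ⟨R', hR'⟩ := dvd_iff_isRoot.2 hr
  have hR'0 : R' ≠ 0 := fun h => hR0 (by rw [hR', h, mul_zero])
  have hR'deg : R'.degree = 0 := by
    rw [hR', degree_mul, degree_X_sub_C, degree_eq_natDegree hR'0] at hRdeg
    rw [degree_eq_natDegree hR'0]
    norm_cast at hRdeg ⊢
    omega
  obtain ⟨a, ha⟩ : ∃ a, R' = C a := ⟨_, eq_C_of_degree_eq_zero hR'deg⟩
  have ha0 : a ≠ 0 := fun h => hR'0 (by rw [ha, h, C_0])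
  have hmem : (∏ t ∈ T', (X - C t)) * (X - C r) ∈ robinSubmodule η κ := by
    have := (robinSubmodule η κ).smul_mem a⁻¹ hP.1
    rw [hR, hR', ha, smul_eq_C_mul] at this
    convert this using 1
    rw [show C a⁻¹ * ((∏ t ∈ T', (X - C t)) * ((X - C r) * C a)) =
      (C a⁻¹ * C a) * ((∏ t ∈ T', (X - C t)) * (X - C r)) by ring, ← C_mul,
      inv_mul_cancel₀ ha0, C_1, one_mul]
  have hrη : r < -η := by
    rw [(mul_X_sub_C_mem_robinSubmodule_iff hκ hσ hq hq').1 hmem]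
    have : 0 < κ / (1 + κ * σ) := by positivity
    linarith
  refine ⟨Fin.cons r (T'.orderEmbOfFin hcard'), ?_, ?_, by simpa using hrη⟩
  · exact strictMono_fin_cons (T'.orderEmbOfFin hcard').strictMono fun i =>
      hrη.trans (hη _ (hT _ (hT' (T'.orderEmbOfFin_mem hcard' i))).1)
  · intro i
    refine Fin.cases ?_ (fun j => ?_) i
    · rw [Fin.cons_zero, IsRoot, hR, eval_mul, hr.eq_zero, mul_zero]
    · rw [Fin.cons_succ]
      exact (hT _ (hT' (T'.orderEmbOfFin_mem hcard' j))).2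

/-- By the degree bound, `n` distinct zeros exhaust the multiset of roots, so any increasing list of
them is the sorted list. -/
theorem orderedZero_eq {n : ℕ} {P : ℝ[X]} {z : Fin n → ℝ} (hP : P ≠ 0) (hd : P.natDegree ≤ n)
    (hz : StrictMono z) (hr : ∀ i, P.IsRoot (z i)) :
    HasSimpleRealZeros P n ∧ ∀ i : Fin n, orderedZero P (i + 1) = z i := by
  have hle : (Multiset.ofList (List.ofFn z)) ≤ P.roots := by
    rw [Multiset.le_iff_subset]
    · intro x hx
      obtain ⟨i, rfl⟩ := List.mem_ofFn.1 (Multiset.mem_coe.1 hx)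
      exact (mem_roots hP).2 (hr i)
    · exact Multiset.coe_nodup.2 (List.nodup_ofFn.2 hz.injective)
  have heq : (Multiset.ofList (List.ofFn z)) = P.roots := by
    refine Multiset.eq_of_le_of_card_le hle ?_
    rw [Multiset.coe_card, List.length_ofFn]
    exact (card_roots' P).trans hd
  have hcard : P.roots.card = n := by rw [← heq, Multiset.coe_card, List.length_ofFn]
  refine ⟨⟨le_antisymm hd (hcard ▸ card_roots' P), ?_, hcard⟩, fun i => ?_⟩
  · rw [← heq]; exact Multiset.coe_nodup.2 (List.nodup_ofFn.2 hz.injective)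
  · have : P.roots.sort (· ≤ ·) = List.ofFn z := by
      rw [← heq, Multiset.coe_sort]
      refine List.mergeSort_of_pairwise (List.pairwise_ofFn.2 fun i j hij => ?_)
      simpa using (hz hij).le
    rw [orderedZero, this]
    simp

/-- Zeros of a pointwise limit with simple zeros are limits of zeros. -/
theorem tendsto_zeros_of_eval {ι : Type*} {l : Filter ι} {n : ℕ} {p : ι → ℝ[X]} {q : ℝ[X]}
    {z : Fin n → ℝ} (hq : q ≠ 0) (hd : q.natDegree ≤ n) (hz : StrictMono z)
    (hr : ∀ i, q.IsRoot (z i)) (hp : ∀ x, Tendsto (fun i => (p i).eval x) l (𝓝 (q.eval x)))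
    {ε : ℝ} (hε : 0 < ε) :
    ∀ᶠ i in l, ∃ y : Fin n → ℝ, StrictMono y ∧ (∀ j, (p i).IsRoot (y j)) ∧
      ∀ j, |y j - z j| < ε := by
  have hnd := (orderedZero_eq hq hd hz hr).1.2.1
  -- Simplicity gives a sign change across each zero, which persists for `p i`; disjointness of the
  -- intervals (`h2`) keeps the zeros in order. The degree of `p i` may exceed `n`, and its other
  -- zeros are ignored.
  have h1 : ∀ᶠ δ in 𝓝[>] (0 : ℝ), ∀ j, q.eval (z j + δ) * q.eval (z j - δ) < 0 := by
    refine eventually_all.2 fun j => ?_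
    obtain ⟨R, hR⟩ := dvd_iff_isRoot.2 (hr j)
    have hR0 : R.eval (z j) ≠ 0 := by
      intro h0
      obtain ⟨R', hR'⟩ := dvd_iff_isRoot.2 (show R.IsRoot (z j) from h0)
      have h2 : 2 ≤ q.rootMultiplicity (z j) :=
        (le_rootMultiplicity_iff hq).2 ⟨R', by rw [hR, hR']; ring⟩
      have h3 := Multiset.nodup_iff_count_le_one.1 hnd (z j)
      rw [count_roots] at h3
      omega
    have hlim : Tendsto (fun δ : ℝ => R.eval (z j + δ) * R.eval (z j - δ)) (𝓝[>] 0)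
        (𝓝 (R.eval (z j) * R.eval (z j))) := by
      have : Continuous fun δ : ℝ => R.eval (z j + δ) * R.eval (z j - δ) := by fun_prop
      simpa using (this.tendsto 0).mono_left nhdsWithin_le_nhds
    filter_upwards [hlim.eventually (lt_mem_nhds (mul_self_pos.2 hR0)), self_mem_nhdsWithin]
      with δ hδ hδ0
    have hδ0 : 0 < δ := hδ0
    have : q.eval (z j + δ) * q.eval (z j - δ) =
        -(δ * δ * (R.eval (z j + δ) * R.eval (z j - δ))) := by
      rw [hR]; simp only [eval_mul, eval_sub, eval_X, eval_C]; ring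
    rw [this]
    exact neg_neg_of_pos (by positivity)
  have h2 : ∀ᶠ δ in 𝓝[>] (0 : ℝ), ∀ i j, i < j → z i + δ < z j - δ := by
    refine eventually_all.2 fun i => eventually_all.2 fun j => ?_
    by_cases hij : i < j
    · have h0 := hz hij
      have : 0 < (z j - z i) / 2 := by linarith
      filter_upwards [nhdsWithin_le_nhds (gt_mem_nhds this)] with δ hδ _
      linarith
    · exact Eventually.of_forall fun _ h => absurd h hij
  obtain ⟨δ, ⟨⟨hδ1, hδ2⟩, hδε⟩, hδ0⟩ := (((h1.and h2).and
    (nhdsWithin_le_nhds (gt_mem_nhds hε))).and self_mem_nhdsWithin).exists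
  have hδ0 : 0 < δ := hδ0
  have h3 : ∀ᶠ i in l, ∀ j, (p i).eval (z j + δ) * (p i).eval (z j - δ) < 0 :=
    eventually_all.2 fun j => ((hp _).mul (hp _)).eventually (gt_mem_nhds (hδ1 j))
  filter_upwards [h3] with i hi
  have h4 : ∀ j, ∃ y ∈ Set.Icc (z j - δ) (z j + δ), (p i).IsRoot y := by
    intro j
    have hsub := intermediate_value_uIcc (a := z j - δ) (b := z j + δ)
      (f := fun x => (p i).eval x) (p i).continuous.continuousOn
    have h0 : (0 : ℝ) ∈ Set.uIcc ((p i).eval (z j - δ)) ((p i).eval (z j + δ)) := by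
      rcases mul_neg_iff.1 (hi j) with h | h
      · exact Set.mem_uIcc.2 (Or.inl ⟨h.2.le, h.1.le⟩)
      · exact Set.mem_uIcc.2 (Or.inr ⟨h.1.le, h.2.le⟩)
    obtain ⟨y, hy, hy0⟩ := hsub h0
    rw [Set.uIcc_of_le (by linarith)] at hy
    exact ⟨y, hy, hy0⟩
  choose y hy hy0 using h4
  refine ⟨y, fun a b hab => ?_, hy0, fun j => ?_⟩
  · exact ((hy a).2.trans_lt (hδ2 a b hab)).trans_le (hy b).1
  · rw [abs_lt]
    have := hy j
    constructor <;> linarith [this.1, this.2]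

end Zeros

/-! ### Functionals given by positive weights -/

section Weights
open MeasureTheory

/-- `w` is a positive weight with finite moments on the nonempty open interval `S`. -/
structure IsPolyWeight (S : Set ℝ) (w : ℝ → ℝ) : Prop where
  isOpen : IsOpen S
  ordConnected : S.OrdConnected
  nonempty : S.Nonempty
  pos : ∀ x ∈ S, 0 < w x
  integrable : ∀ k : ℕ, IntegrableOn (fun x => x ^ k * w x) S

/-- The linear functional on polynomials whose moments are those of `w` on `S`. -/
noncomputable def weightFunctional (S : Set ℝ) (w : ℝ → ℝ) : ℝ[X] →ₗ[ℝ] ℝ :=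
  Polynomial.lsum fun k => (∫ x in S, x ^ k * w x) • LinearMap.id

theorem weightFunctional_apply (S : Set ℝ) (w : ℝ → ℝ) (P : ℝ[X]) :
    weightFunctional S w P = ∑ k ∈ P.support, (∫ x in S, x ^ k * w x) * P.coeff k := by
  simp [weightFunctional, Polynomial.lsum_apply, Polynomial.sum_def]

theorem weightFunctional_X_pow (S : Set ℝ) (w : ℝ → ℝ) (k : ℕ) :
    weightFunctional S w (X ^ k) = ∫ x in S, x ^ k * w x := by
  rw [weightFunctional_apply, support_X_pow, Finset.sum_singleton, coeff_X_pow_self,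
    mul_one]

variable {S : Set ℝ} {w : ℝ → ℝ}

theorem eval_mul_eq_sum (P : ℝ[X]) (x y : ℝ) :
    P.eval x * y = ∑ k ∈ P.support, P.coeff k * (x ^ k * y) := by
  rw [eval_eq_sum, Polynomial.sum_def, Finset.sum_mul]
  simp only [mul_assoc]

theorem IsPolyWeight.integrable_eval (h : IsPolyWeight S w) (P : ℝ[X]) :
    IntegrableOn (fun x => P.eval x * w x) S := by
  simp only [eval_mul_eq_sum]
  exact integrable_finsetSum _ fun k _ => (h.integrable k).const_mul _

/-- The functional is built from moments, hence linear by construction; only its expression as an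
integral needs integrability. -/
theorem IsPolyWeight.weightFunctional_eq (h : IsPolyWeight S w) (P : ℝ[X]) :
    weightFunctional S w P = ∫ x in S, P.eval x * w x := by
  simp only [eval_mul_eq_sum]
  rw [integral_finsetSum _ fun k _ => (h.integrable k).const_mul _, weightFunctional_apply]
  exact Finset.sum_congr rfl fun k _ => by rw [integral_const_mul, mul_comm]

/-- The integrand vanishes on `S` only at finitely many points, and a nonempty open set has positive
measure. -/
theorem IsPolyWeight.weightFunctional_pos (h : IsPolyWeight S w) {P : ℝ[X]} (hP : P ≠ 0)
    (hS : ∀ x ∈ S, 0 ≤ P.eval x) : 0 < weightFunctional S w P := by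
  rw [h.weightFunctional_eq, setIntegral_pos_iff_support_of_nonneg_ae _ (h.integrable_eval P)]
  · have hsub : S \ P.roots.toFinset ⊆ Function.support (fun x => P.eval x * w x) ∩ S := by
      intro x hx
      refine ⟨mul_ne_zero (fun h0 => hx.2 ?_) (h.pos x hx.1).ne', hx.1⟩
      simp [hP, h0]
    refine lt_of_lt_of_le ?_ (measure_mono hsub)
    rw [measure_sdiff_null (Finset.measure_zero _ _)]
    exact h.isOpen.measure_pos _ h.nonempty
  · refine (ae_restrict_iff' h.isOpen.measurableSet).2 (Eventually.of_forall fun x hx => ?_)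
    exact mul_nonneg (hS x hx) (h.pos x hx).le

theorem IsPolyWeight.weightFunctional_mul_self_pos (h : IsPolyWeight S w) (P : ℝ[X])
    (hP : P ≠ 0) : 0 < weightFunctional S w (P * P) :=
  h.weightFunctional_pos (mul_ne_zero hP hP) fun x _ => by
    rw [eval_mul]; exact mul_self_nonneg _

theorem isOrthogonalIn_gramSchmidtPoly_robin (h : IsPolyWeight S w) {η κ : ℝ} {u : ℕ → ℝ[X]}
    (hu : ∀ j, u j ∈ robinSubmodule η κ) (hd : ∀ j, (u j).natDegree ≤ j + 1)
    (hc : ∀ j, (u j).coeff (j + 1) ≠ 0) (m : ℕ) :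
    IsOrthogonalIn (weightFunctional S w) (robinSubmodule η κ) (m + 1)
      (gramSchmidtPoly (functionalForm (weightFunctional S w)) u m) ∧
    (gramSchmidtPoly (functionalForm (weightFunctional S w)) u m).coeff (m + 1) ≠ 0 := by
  have hd' : ∀ j, (u j).degree < (j + 1 + 1 : ℕ) := fun j =>
    lt_of_le_of_lt degree_le_natDegree (by exact_mod_cast Nat.lt_succ_of_le (hd j))
  refine ⟨isOrthogonalIn_gramSchmidtPoly h.weightFunctional_mul_self_pos hu
    (fun Q hQ hQd => eq_zero_of_mem_robinSubmodule hQ hQd) hd' hc m, ?_⟩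
  rw [gramSchmidtPoly_coeff u _ 1 hd']
  exact hc m

/-- The sequence `x + η + κ, (x + η)², (x + η)³, …`. -/
noncomputable def robinSeq (η κ : ℝ) : ℕ → ℝ[X]
  | 0 => X + C (η + κ)
  | j + 1 => (X + C η) ^ (j + 2)

theorem laguerreSeq_eq (α : ℝ) : laguerreSeq α = robinSeq α 1 := by
  funext j
  cases j <;> rfl

theorem robinSeq_mem (η κ : ℝ) (j : ℕ) : robinSeq η κ j ∈ robinSubmodule η κ := by
  rw [mem_robinSubmodule]
  cases j with
  | zero => simp [robinSeq]
  | succ j => simp [robinSeq, derivative_pow]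

theorem monic_robinSeq (η κ : ℝ) (j : ℕ) : (robinSeq η κ j).Monic := by
  cases j with
  | zero => exact monic_X_add_C _
  | succ j => exact (monic_X_add_C _).pow _

theorem natDegree_robinSeq (η κ : ℝ) (j : ℕ) : (robinSeq η κ j).natDegree = j + 1 := by
  cases j with
  | zero => exact natDegree_X_add_C _
  | succ j => rw [robinSeq, natDegree_pow, natDegree_X_add_C, mul_one]

theorem isOrthogonalIn_robinSeq (h : IsPolyWeight S w) (η κ : ℝ) (m : ℕ) :
    IsOrthogonalIn (weightFunctional S w) (robinSubmodule η κ) (m + 1)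
      (gramSchmidtPoly (functionalForm (weightFunctional S w)) (robinSeq η κ) m) ∧
    (gramSchmidtPoly (functionalForm (weightFunctional S w)) (robinSeq η κ) m).coeff (m + 1)
      ≠ 0 := by
  refine isOrthogonalIn_gramSchmidtPoly_robin h (robinSeq_mem η κ)
    (fun j => (natDegree_robinSeq η κ j).le) (fun j => ?_) m
  have h1 := monic_robinSeq η κ j
  rw [Monic, leadingCoeff, natDegree_robinSeq] at h1
  rw [h1]
  exact one_ne_zero

theorem IsOrthogonalIn.zeros_weight (h : IsPolyWeight S w) {η κ : ℝ} (hη : ∀ x ∈ S, -η < x)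
    (hκ : 0 < κ) {m : ℕ} {P : ℝ[X]}
    (hP : IsOrthogonalIn (weightFunctional S w) (robinSubmodule η κ) (m + 1) P)
    (hc : P.coeff (m + 1) ≠ 0) :
    ∃ z : Fin (m + 1) → ℝ, StrictMono z ∧ (∀ i, P.IsRoot (z i)) ∧ z 0 < -η :=
  hP.zeros_robinSubmodule h.ordConnected hη hκ (fun _ => h.weightFunctional_pos) hc

theorem setIntegral_affine {a b : ℝ} (ha : a ≠ 0) {S T : Set ℝ} (hS : MeasurableSet S)
    (hT : ∀ x, a * x + b ∈ T ↔ x ∈ S) (g : ℝ → ℝ) :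
    ∫ x in T, g x = |a| * ∫ x in S, g (a * x + b) := by
  have himg : (fun x => a * x + b) '' S = T := by
    ext y
    constructor
    · rintro ⟨x, hx, rfl⟩
      exact (hT x).2 hx
    · intro hy
      refine ⟨(y - b) / a, (hT _).1 ?_, ?_⟩
      · convert hy using 1; field_simp; ring
      · field_simp; ring
  rw [← himg, integral_image_eq_integral_abs_deriv_smul (f' := fun _ => a) hS
    (fun x _ => ?_) (fun x _ y _ hxy => ?_)]
  · simp only [smul_eq_mul, integral_const_mul]
  · have := ((hasDerivAt_id x).const_mul a).add_const b
    simpa using this.hasDerivWithinAt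
  · simpa [ha] using hxy

/-- Affine change of variables between an inner product and a weight functional. -/
theorem setIntegral_eq_functionalForm (h : IsPolyWeight S w) {a b K : ℝ} (ha : a ≠ 0)
    {T : Set ℝ} (hT : ∀ x, a * x + b ∈ T ↔ x ∈ S) {W : ℝ → ℝ}
    (hW : ∀ x ∈ S, |a| * W (a * x + b) = K * w x) (P Q : ℝ[X]) :
    ∫ x in T, P.eval x * Q.eval x * W x = K * functionalForm (weightFunctional S w)
      (P.comp (C a * X + C b)) (Q.comp (C a * X + C b)) := by
  rw [setIntegral_affine ha h.isOpen.measurableSet hT, functionalForm, h.weightFunctional_eq,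
    ← integral_const_mul, ← integral_const_mul]
  refine setIntegral_congr_fun h.isOpen.measurableSet fun x hx => ?_
  simp only [eval_mul, eval_comp, eval_add, eval_C, eval_X]
  linear_combination (P.eval (a * x + b) * Q.eval (a * x + b)) * hW x hx

end Weights

/-! ### From `X₁`-Jacobi to `X₁`-Laguerre -/

section JacobiLaguerre
open MeasureTheory

/-- The `X₁`-Laguerre weight. -/
noncomputable def laguerreWeight (α x : ℝ) : ℝ := Real.exp (-x) * x ^ α / (x + α) ^ 2

theorem integrableOn_pow_mul_rpow_mul_exp {α : ℝ} (hα : 0 < α) (k : ℕ) :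
    IntegrableOn (fun x : ℝ => x ^ k * (x ^ α * Real.exp (-x))) (Set.Ioi 0) := by
  have h := Real.GammaIntegral_convergent (s := k + α + 1) (by positivity)
  refine h.congr_fun (fun x hx => ?_) measurableSet_Ioi
  have hx : 0 < x := hx
  simp only
  rw [add_sub_cancel_right, Real.rpow_add hx, Real.rpow_natCast]
  ring

theorem isPolyWeight_laguerre {α : ℝ} (hα : 0 < α) :
    IsPolyWeight (Set.Ioi 0) (laguerreWeight α) where
  isOpen := isOpen_Ioi
  ordConnected := Set.ordConnected_Ioi
  nonempty := Set.nonempty_Ioi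
  pos x hx := by
    have hx : 0 < x := hx
    have := Real.rpow_pos_of_pos hx α
    unfold laguerreWeight
    positivity
  integrable k := by
    refine ((integrableOn_pow_mul_rpow_mul_exp hα k).div_const (α ^ 2)).mono'
      (ContinuousOn.aestronglyMeasurable ?_ measurableSet_Ioi)
      ((ae_restrict_iff' measurableSet_Ioi).2 (Eventually.of_forall fun x hx => ?_))
    · unfold laguerreWeight
      intro x hx
      have hx : 0 < x := hx
      refine ContinuousAt.continuousWithinAt ?_
      have h1 : ContinuousAt (fun x : ℝ => x ^ α) x := Real.continuousAt_rpow_const _ _ (Or.inl hx.ne')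
      have h2 : (x + α) ^ 2 ≠ 0 := by positivity
      fun_prop (disch := assumption)
    · have hx : 0 < x := hx
      have h1 := Real.rpow_pos_of_pos hx α
      unfold laguerreWeight
      rw [Real.norm_of_nonneg (by positivity), mul_div_assoc', mul_comm (Real.exp (-x))]
      gcongr
      linarith

theorem laguerreInner_eq {α : ℝ} (hα : 0 < α) :
    laguerreInner α = functionalForm (weightFunctional (Set.Ioi 0) (laguerreWeight α)) := by
  funext P Q
  rw [functionalForm, (isPolyWeight_laguerre hα).weightFunctional_eq, laguerreInner]
  simp only [eval_mul, laguerreWeight]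

theorem x1Laguerre_succ {α : ℝ} (hα : 0 < α) (m : ℕ) :
    x1Laguerre α (m + 1) = gramSchmidtPoly
      (functionalForm (weightFunctional (Set.Ioi 0) (laguerreWeight α))) (robinSeq α 1) m := by
  rw [x1Laguerre, laguerreInner_eq hα, laguerreSeq_eq, Nat.add_sub_cancel]

/-- The zeros of the `X₁`-Laguerre polynomial. -/
theorem x1Laguerre_zeros {α : ℝ} (hα : 0 < α) (m : ℕ) :
    x1Laguerre α (m + 1) ≠ 0 ∧ (x1Laguerre α (m + 1)).natDegree ≤ m + 1 ∧
    ∃ z : Fin (m + 1) → ℝ, StrictMono z ∧ (∀ i, (x1Laguerre α (m + 1)).IsRoot (z i)) ∧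
      z 0 < -α := by
  rw [x1Laguerre_succ hα]
  have h := isPolyWeight_laguerre hα
  obtain ⟨h1, h2⟩ := isOrthogonalIn_robinSeq h α 1 m
  exact ⟨fun h0 => h2 (by rw [h0, coeff_zero]), natDegree_le_of_degree_lt_succ h1.2.1,
    h1.zeros_weight h (fun x (hx : 0 < x) => by linarith) one_pos h2⟩

/-- Minus the image of `b` under `x ↦ β (1 - x) / 2`. -/
noncomputable def jacobiEta (α β : ℝ) : ℝ := α * β / (β - α)

/-- The difference of the images of `b` and `c` under `x ↦ β (1 - x) / 2`. -/
noncomputable def jacobiKappa (α β : ℝ) : ℝ := β / (β - α)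

/-- The `X₁`-Jacobi weight in the variable `t = β (1 - x) / 2`, up to a constant factor. -/
noncomputable def jacobiWeight (α β t : ℝ) : ℝ :=
  t ^ α * (1 - t / β) ^ β / (t + jacobiEta α β) ^ 2

theorem le_jacobiEta {α β : ℝ} (hα : 0 < α) (hβ : α < β) : α ≤ jacobiEta α β := by
  have : 0 < β - α := by linarith
  rw [jacobiEta, le_div_iff₀ this]
  nlinarith

theorem jacobiWeight_nonneg {α β t : ℝ} (ht : t ∈ Set.Ioo 0 β) : 0 ≤ jacobiWeight α β t := by
  have hβ : 0 < β := ht.1.trans ht.2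
  have h1 : 0 < 1 - t / β := by rw [sub_pos, div_lt_one hβ]; exact ht.2
  have := Real.rpow_nonneg h1.le β
  have := Real.rpow_nonneg ht.1.le α
  unfold jacobiWeight
  positivity

/-- A bound independent of `β`, from `1 - y ≤ e^{-y}` and `η ≥ α`; it gives both integrability and
the domination needed for the limit. -/
theorem jacobiWeight_le {α β t : ℝ} (hα : 0 < α) (hβ : α < β) (ht : t ∈ Set.Ioo 0 β) :
    jacobiWeight α β t ≤ t ^ α * Real.exp (-t) / α ^ 2 := by
  have hβ0 : 0 < β := ht.1.trans ht.2
  have h1 : 0 < 1 - t / β := by rw [sub_pos, div_lt_one hβ0]; exact ht.2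
  have h2 := le_jacobiEta hα hβ
  have h3 : (1 - t / β) ^ β ≤ Real.exp (-t) := by
    calc (1 - t / β) ^ β ≤ Real.exp (-(t / β)) ^ β :=
          Real.rpow_le_rpow h1.le (by have := Real.add_one_le_exp (-(t / β)); linarith) hβ0.le
      _ = Real.exp (-t) := by rw [← Real.exp_mul]; congr 1; field_simp
  have := Real.rpow_nonneg ht.1.le α
  have := ht.1
  unfold jacobiWeight
  gcongr
  linarith

theorem continuousOn_jacobiWeight {α β : ℝ} (hα : 0 < α) (hβ : α < β) :
    ContinuousOn (jacobiWeight α β) (Set.Ioo 0 β) := by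
  intro x hx
  refine ContinuousAt.continuousWithinAt ?_
  have hβ0 : 0 < β := hx.1.trans hx.2
  have h1 : ContinuousAt (fun x : ℝ => x ^ α) x :=
    Real.continuousAt_rpow_const _ _ (Or.inl hx.1.ne')
  have h2 : ContinuousAt (fun x : ℝ => (1 - x / β) ^ β) x :=
    ContinuousAt.rpow_const (by fun_prop) (Or.inr hβ0.le)
  have h3 := le_jacobiEta hα hβ
  have h4 : (x + jacobiEta α β) ^ 2 ≠ 0 := pow_ne_zero 2 (by linarith [hx.1])
  unfold jacobiWeight
  fun_prop (disch := assumption)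

theorem isPolyWeight_jacobi {α β : ℝ} (hα : 0 < α) (hβ : α < β) :
    IsPolyWeight (Set.Ioo 0 β) (jacobiWeight α β) where
  isOpen := isOpen_Ioo
  ordConnected := Set.ordConnected_Ioo
  nonempty := Set.nonempty_Ioo.2 (hα.trans hβ)
  pos t ht := by
    have hβ : 0 < β := ht.1.trans ht.2
    have h1 : 0 < 1 - t / β := by rw [sub_pos, div_lt_one hβ]; exact ht.2
    have := Real.rpow_pos_of_pos h1 β
    have := Real.rpow_pos_of_pos ht.1 α
    have h3 : α ≤ jacobiEta α β := le_jacobiEta hα ‹α < β›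
    have h4 : 0 < jacobiEta α β := hα.trans_le h3
    have := ht.1
    unfold jacobiWeight
    positivity
  integrable k := by
    refine (((integrableOn_pow_mul_rpow_mul_exp hα k).mono_set
      Set.Ioo_subset_Ioi_self).div_const (α ^ 2)).mono'
      (ContinuousOn.aestronglyMeasurable ((continuousOn_id.pow k).mul
        (continuousOn_jacobiWeight hα hβ)) measurableSet_Ioo)
      ((ae_restrict_iff' measurableSet_Ioo).2 (Eventually.of_forall fun x hx => ?_))
    have hx0 : 0 < x := hx.1
    rw [Real.norm_of_nonneg (mul_nonneg (by positivity) (jacobiWeight_nonneg hx)), mul_div_assoc]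
    exact mul_le_mul_of_nonneg_left (jacobiWeight_le hα hβ hx) (by positivity)

theorem exists_jacobiInner_eq {α β : ℝ} (hα : 0 < α) (hβ : α < β) :
    ∃ K : ℝ, K ≠ 0 ∧ ∀ P Q, jacobiInner α β P Q = K * functionalForm
      (weightFunctional (Set.Ioo 0 β) (jacobiWeight α β))
      (P.comp (C (-(2 / β)) * X + C 1)) (Q.comp (C (-(2 / β)) * X + C 1)) := by
  have hβ0 : 0 < β := hα.trans hβ
  have hβα : 0 < β - α := by linarith
  have hpos1 := Real.rpow_pos_of_pos (show 0 < 2 / β by positivity) α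
  have hpos2 := Real.rpow_pos_of_pos (show (0 : ℝ) < 2 by positivity) β
  -- With `x = 1 - 2t/β`, the factors come from `dx`, `(1 - x)^α`, `(1 + x)^β` and `(x - b)²`, in
  -- this order.
  refine ⟨(2 / β) * ((2 / β) ^ α * 2 ^ β) / (2 / β) ^ 2, by positivity, fun P Q => ?_⟩
  refine setIntegral_eq_functionalForm (isPolyWeight_jacobi hα hβ)
    (neg_ne_zero.2 (by positivity)) (fun x => ?_) (fun x hx => ?_) P Q
  · have e : β * (2 / β) = 2 := by field_simp
    constructor
    · rintro ⟨h1, h2⟩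
      constructor <;> by_contra! h
      · nlinarith [mul_nonneg (neg_nonneg.2 h) (by positivity : 0 ≤ 2 / β)]
      · nlinarith [mul_nonneg (sub_nonneg.2 h) (by positivity : 0 ≤ 2 / β)]
    · rintro ⟨h1, h2⟩
      constructor
      · nlinarith [mul_pos (sub_pos.2 h2) (by positivity : 0 < 2 / β)]
      · nlinarith [mul_pos h1 (by positivity : 0 < 2 / β)]
  · have hx0 : 0 < x := hx.1
    have h1 : 0 < 1 - x / β := by rw [sub_pos, div_lt_one hβ0]; exact hx.2
    have h2 := le_jacobiEta hα hβ
    have h3 : 0 < x + jacobiEta α β := by linarith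
    have e1 : 1 - (-(2 / β) * x + 1) = (2 / β) * x := by ring
    have e2 : 1 + (-(2 / β) * x + 1) = 2 * (1 - x / β) := by ring
    have e3 : -(2 / β) * x + 1 - jacobiB α β = -(2 / β) * (x + jacobiEta α β) := by
      rw [jacobiB, jacobiEta]; field_simp; ring
    rw [e1, e2, e3, Real.mul_rpow (by positivity) hx0.le, Real.mul_rpow (by positivity) h1.le,
      abs_neg, abs_of_pos (by positivity), jacobiWeight]
    field_simp

/-- The substitution takes `b` to `-η` and `c` to `-η - κ`, so the two starting sequences correspond
up to powers of `-2/β`. -/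
theorem x1Jacobi_comp {α β : ℝ} (hα : 0 < α) (hβ : α < β) (m : ℕ) :
    (x1Jacobi α β (m + 1)).comp (C (-(2 / β)) * X + C 1) =
      (-(2 / β)) ^ (m + 1) • gramSchmidtPoly
        (functionalForm (weightFunctional (Set.Ioo 0 β) (jacobiWeight α β)))
        (robinSeq (jacobiEta α β) (jacobiKappa α β)) m := by
  obtain ⟨K, hK, hB⟩ := exists_jacobiInner_eq hα hβ
  have hβ0 : β ≠ 0 := (hα.trans hβ).ne'
  have hβα : β - α ≠ 0 := by linarith
  rw [x1Jacobi, Nat.add_sub_cancel]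
  refine gramSchmidtPoly_comp (c := fun j => (-(2 / β)) ^ (j + 1)) hK
    (fun j => pow_ne_zero _ (by simp [hβ0])) hB functionalForm_smul_smul (fun j => ?_) m
  have key : ∀ r e : ℝ, 1 - r = -(2 / β) * e →
      (X - C r).comp (C (-(2 / β)) * X + C 1) = C (-(2 / β)) * (X + C e) := by
    intro r e h
    rw [sub_comp, X_comp, C_comp, mul_add, ← C_mul, ← h, C_sub]
    ring
  cases j with
  | zero =>
    rw [jacobiSeq, robinSeq, key _ (jacobiEta α β + jacobiKappa α β), smul_eq_C_mul]
    · simp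
    · rw [jacobiC, jacobiA, jacobiB, jacobiEta, jacobiKappa]; field_simp; ring
  | succ j =>
    rw [jacobiSeq, robinSeq, pow_comp, key _ (jacobiEta α β), smul_eq_C_mul, mul_pow, C_pow]
    · rw [jacobiB, jacobiEta]; field_simp; ring

/-- The zeros of the `X₁`-Jacobi polynomial are the images of those of a polynomial in
`t = β (1 - x) / 2`. -/
theorem x1Jacobi_zeros {α β : ℝ} (hα : 0 < α) (hβ : α < β) {m : ℕ} {y : Fin (m + 1) → ℝ}
    (hy : StrictMono y) (hr : ∀ i, (gramSchmidtPoly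
        (functionalForm (weightFunctional (Set.Ioo 0 β) (jacobiWeight α β)))
        (robinSeq (jacobiEta α β) (jacobiKappa α β)) m).IsRoot (y i)) :
    HasSimpleRealZeros (x1Jacobi α β (m + 1)) (m + 1) ∧
      ∀ i : Fin (m + 1), β * (1 - orderedZero (x1Jacobi α β (m + 1)) (i + 1)) / 2 = y i.rev := by
  have hβ0 : 0 < β := hα.trans hβ
  have hcomp := x1Jacobi_comp hα hβ m
  obtain ⟨h1, h2⟩ := isOrthogonalIn_robinSeq (isPolyWeight_jacobi hα hβ) (jacobiEta α β)
    (jacobiKappa α β) m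
  have hne : x1Jacobi α β (m + 1) ≠ 0 := by
    intro h
    rw [h, zero_comp] at hcomp
    have := smul_eq_zero.1 hcomp.symm
    rcases this with h | h
    · exact pow_ne_zero _ (neg_ne_zero.2 (by positivity)) h
    · exact h2 (by rw [h, coeff_zero])
  have hdeg : (x1Jacobi α β (m + 1)).natDegree ≤ m + 1 := by
    have e := congrArg natDegree hcomp
    rw [natDegree_comp, natDegree_linear (neg_ne_zero.2 (by positivity)), mul_one] at e
    rw [e]
    exact (natDegree_smul_le _ _).trans (natDegree_le_of_degree_lt_succ h1.2.1)
  -- The substitution reverses orientation, hence `rev` here and the index `n + 1 - k` in the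
  -- theorem.
  have hz : StrictMono fun i : Fin (m + 1) => 1 - 2 / β * y i.rev := by
    intro i j hij
    have := hy (Fin.rev_lt_rev.2 hij)
    have h2 : 0 < 2 / β := by positivity
    simp only
    nlinarith
  obtain ⟨h3, h4⟩ := orderedZero_eq hne hdeg hz fun i => by
    have e := congrArg (eval (y i.rev)) hcomp
    rw [eval_comp, eval_smul, (hr i.rev).eq_zero, smul_zero] at e
    rw [IsRoot, ← e]
    congr 1
    simp only [eval_add, eval_mul, eval_C, eval_X]
    ring
  refine ⟨h3, fun i => ?_⟩
  rw [h4]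
  field_simp
  ring

theorem tendsto_jacobiKappa (α : ℝ) : Tendsto (jacobiKappa α) atTop (𝓝 1) := by
  have h : Tendsto (fun β : ℝ => 1 + α / (β - α)) atTop (𝓝 (1 + 0)) :=
    ((tendsto_atTop_add_const_right _ (-α) tendsto_id).const_div_atTop α).const_add 1
  rw [add_zero] at h
  refine h.congr' ?_
  filter_upwards [eventually_gt_atTop α] with β hβ
  have : β - α ≠ 0 := by linarith
  rw [jacobiKappa]
  field_simp
  ring

theorem tendsto_jacobiEta (α : ℝ) : Tendsto (jacobiEta α) atTop (𝓝 α) := by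
  have h := (tendsto_jacobiKappa α).const_mul α
  rw [mul_one] at h
  exact h.congr fun β => by rw [jacobiKappa, jacobiEta, mul_div_assoc]

theorem tendsto_moment_jacobi {α : ℝ} (hα : 0 < α) (k : ℕ) :
    Tendsto (fun β => ∫ t in Set.Ioo 0 β, t ^ k * jacobiWeight α β t) atTop
      (𝓝 (∫ t in Set.Ioi 0, t ^ k * laguerreWeight α t)) := by
  have e : ∀ β, ∫ t in Set.Ioo 0 β, t ^ k * jacobiWeight α β t =
      ∫ t in Set.Ioi 0, (Set.Ioo 0 β).indicator (fun t => t ^ k * jacobiWeight α β t) t := by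
    intro β
    rw [setIntegral_indicator measurableSet_Ioo,
      Set.inter_eq_self_of_subset_right Set.Ioo_subset_Ioi_self]
  simp only [e]
  refine tendsto_integral_filter_of_dominated_convergence
    (fun t => t ^ k * (t ^ α * Real.exp (-t)) / α ^ 2) ?_ ?_
    ((integrableOn_pow_mul_rpow_mul_exp hα k).div_const (α ^ 2)) ?_
  · filter_upwards [eventually_gt_atTop α] with β hβ
    rw [aestronglyMeasurable_indicator_iff measurableSet_Ioo,
      Measure.restrict_restrict measurableSet_Ioo,
      Set.inter_eq_self_of_subset_left Set.Ioo_subset_Ioi_self]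
    exact ((isPolyWeight_jacobi hα hβ).integrable k).1
  · filter_upwards [eventually_gt_atTop α] with β hβ
    refine (ae_restrict_iff' measurableSet_Ioi).2 (Eventually.of_forall fun t ht => ?_)
    have ht : 0 < t := ht
    by_cases h : t ∈ Set.Ioo 0 β
    · rw [Set.indicator_of_mem h, Real.norm_of_nonneg
        (mul_nonneg (by positivity) (jacobiWeight_nonneg h)), mul_div_assoc]
      exact mul_le_mul_of_nonneg_left (jacobiWeight_le hα hβ h) (by positivity)
    · rw [Set.indicator_of_notMem h, norm_zero]
      positivity
  · refine (ae_restrict_iff' measurableSet_Ioi).2 (Eventually.of_forall fun t ht => ?_)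
    have ht : 0 < t := ht
    have h1 : Tendsto (fun β : ℝ => (1 - t / β) ^ β) atTop (𝓝 (Real.exp (-t))) := by
      refine (Real.tendsto_one_add_div_rpow_exp (-t)).congr fun β => ?_
      rw [neg_div, sub_eq_add_neg]
    have h2 : Tendsto (fun β => t ^ k * jacobiWeight α β t) atTop
        (𝓝 (t ^ k * laguerreWeight α t)) := by
      unfold jacobiWeight laguerreWeight
      rw [mul_comm (Real.exp (-t))]
      exact ((h1.const_mul _).div (((tendsto_jacobiEta α).const_add t).pow 2)
        (by positivity)).const_mul _
    refine h2.congr' ?_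
    filter_upwards [eventually_gt_atTop t] with β hβ
    rw [Set.indicator_of_mem (Set.mem_Ioo.2 ⟨ht, hβ⟩)]

theorem polyTendsto_robinSeq {ι : Type*} {l : Filter ι} {η κ : ι → ℝ} {η₀ κ₀ : ℝ}
    (hη : Tendsto η l (𝓝 η₀)) (hκ : Tendsto κ l (𝓝 κ₀)) (j : ℕ) :
    PolyTendsto (fun i => robinSeq (η i) (κ i) j) l (robinSeq η₀ κ₀ j) := by
  cases j with
  | zero => exact (polyTendsto_const X).add (polyTendsto_C (hη.add hκ))
  | succ j => exact ((polyTendsto_const X).add (polyTendsto_C hη)).pow _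

theorem hasSimpleRealZeros_x1Jacobi {α β : ℝ} (hα : 0 < α) (hβ : α < β) (m : ℕ) :
    HasSimpleRealZeros (x1Jacobi α β (m + 1)) (m + 1) := by
  have h := isPolyWeight_jacobi hα hβ
  obtain ⟨h1, h2⟩ := isOrthogonalIn_robinSeq h (jacobiEta α β) (jacobiKappa α β) m
  have h3 := le_jacobiEta hα hβ
  obtain ⟨y, hy, hr, -⟩ := h1.zeros_weight h (fun x hx => by linarith [hx.1])
    (div_pos (hα.trans hβ) (sub_pos.2 hβ)) h2
  exact (x1Jacobi_zeros hα hβ hy hr).1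

theorem tendsto_orderedZero_x1Jacobi {α : ℝ} (hα : 0 < α) {m : ℕ} (i : Fin (m + 1)) :
    Tendsto (fun β : ℝ => β * (1 - orderedZero (x1Jacobi α β (m + 1)) (i + 1)) / 2) atTop
      (𝓝 (orderedZero (x1Laguerre α (m + 1)) (i.rev + 1))) := by
  obtain ⟨hne, hdeg, z, hz, hzr, -⟩ := x1Laguerre_zeros hα m
  rw [(orderedZero_eq hne hdeg hz hzr).2, Metric.tendsto_nhds]
  intro ε hε
  have hL := isPolyWeight_laguerre hα
  have hp := polyTendsto_gramSchmidtPoly (l := atTop)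
    (F := fun β => weightFunctional (Set.Ioo 0 β) (jacobiWeight α β))
    (G := weightFunctional (Set.Ioi 0) (laguerreWeight α))
    (u := fun β => robinSeq (jacobiEta α β) (jacobiKappa α β)) (v := robinSeq α 1)
    (fun k => by simpa only [weightFunctional_X_pow] using tendsto_moment_jacobi hα k)
    (fun j => polyTendsto_robinSeq (tendsto_jacobiEta α) (tendsto_jacobiKappa α) j)
    (fun j => (hL.weightFunctional_mul_self_pos _ fun h =>
      (isOrthogonalIn_robinSeq hL α 1 j).2 (by rw [h, coeff_zero])).ne') m
  rw [← x1Laguerre_succ hα] at hp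
  filter_upwards [tendsto_zeros_of_eval hne hdeg hz hzr hp.eval hε, eventually_gt_atTop α]
    with β ⟨y, hy, hyr, hyz⟩ hβ
  rw [(x1Jacobi_zeros hα hβ hy hyr).2, Real.dist_eq]
  exact hyz _

end JacobiLaguerre

/-! ### From `X₁`-Laguerre to Hermite -/

section LaguerreHermite
open MeasureTheory

/-- The Hermite weight. -/
noncomputable def gaussWeight (s : ℝ) : ℝ := Real.exp (-s ^ 2)

theorem gaussWeight_eq (s : ℝ) : gaussWeight s = Real.exp (-1 * s ^ 2) := by
  rw [gaussWeight, neg_one_mul]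

theorem integrable_pow_mul_gaussWeight (k : ℕ) : Integrable fun s : ℝ => s ^ k * gaussWeight s := by
  have := integrable_rpow_mul_exp_neg_mul_sq (b := 1) one_pos (s := k)
    (by linarith [(Nat.cast_nonneg k : (0 : ℝ) ≤ k)])
  simpa only [Real.rpow_natCast, ← gaussWeight_eq] using this

theorem isPolyWeight_gauss : IsPolyWeight Set.univ gaussWeight where
  isOpen := isOpen_univ
  ordConnected := Set.ordConnected_univ
  nonempty := Set.univ_nonempty
  pos _ _ := Real.exp_pos _
  integrable k := (integrable_pow_mul_gaussWeight k).integrableOn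

/-- Equivalent to `(Hₙ e^{-s²})' = -Hₙ₊₁ e^{-s²}`, the form used for integration by parts. -/
theorem physHermite_succ (n : ℕ) :
    physHermite (n + 1) = 2 * X * physHermite n - derivative (physHermite n) := by
  have h2 : (C √2 * C √2 : ℝ[X]) = 2 := by
    rw [← C_mul, Real.mul_self_sqrt (by norm_num)]; rfl
  simp only [physHermite, Polynomial.hermite_succ, Polynomial.map_sub, Polynomial.map_mul, map_X,
    sub_comp, mul_comp, X_comp, derivative_mul, derivative_C, derivative_comp, derivative_X,
    zero_mul, zero_add, mul_one, ← derivative_map, pow_succ, C_mul, ← h2]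
  ring

theorem physHermite_degree (n : ℕ) :
    (physHermite n).degree < (n + 1 : ℕ) ∧ (physHermite n).coeff n ≠ 0 := by
  have h2 : √2 ≠ 0 := by positivity
  have hd : (physHermite n).natDegree = n := by
    rw [physHermite, natDegree_C_mul (pow_ne_zero _ h2), natDegree_comp,
      natDegree_C_mul_X _ h2, mul_one, (hermite_monic n).natDegree_map, natDegree_hermite]
  have h0 : physHermite n ≠ 0 := by
    rw [physHermite]
    refine mul_ne_zero (C_ne_zero.2 (pow_ne_zero _ h2)) fun h => ?_
    rcases comp_eq_zero_iff.1 h with h | ⟨-, h⟩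
    · exact ((hermite_monic n).map _).ne_zero h
    · have := congrArg natDegree h
      rw [natDegree_C_mul_X _ h2, natDegree_C] at this
      omega
  refine ⟨?_, ?_⟩
  · rw [degree_eq_natDegree h0, hd]; exact_mod_cast n.lt_succ_self
  · conv => enter [1, 2]; rw [← hd]
    exact leadingCoeff_ne_zero.2 h0

theorem weightFunctional_gauss (P : ℝ[X]) :
    weightFunctional Set.univ gaussWeight P = ∫ s, P.eval s * gaussWeight s := by
  rw [isPolyWeight_gauss.weightFunctional_eq, setIntegral_univ]

theorem integrable_eval_gauss (P : ℝ[X]) : Integrable fun s => P.eval s * gaussWeight s :=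
  integrableOn_univ.1 (isPolyWeight_gauss.integrable_eval P)

theorem weightFunctional_physHermite_succ (n : ℕ) (P : ℝ[X]) :
    weightFunctional Set.univ gaussWeight (physHermite (n + 1) * P) =
      weightFunctional Set.univ gaussWeight (physHermite n * derivative P) := by
  have h := integral_mul_deriv_eq_deriv_mul_of_integrable (u := fun s => P.eval s)
    (u' := fun s => (derivative P).eval s) (v := fun s => (physHermite n).eval s * gaussWeight s)
    (v' := fun s => -((physHermite (n + 1)).eval s * gaussWeight s))
    (fun s _ => P.hasDerivAt s) (fun s _ => ?_) ?_ ?_ ?_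
  · rw [weightFunctional_gauss, weightFunctional_gauss]
    simp only [mul_neg, integral_neg, neg_inj] at h
    calc ∫ s, (physHermite (n + 1) * P).eval s * gaussWeight s
        = ∫ s, P.eval s * ((physHermite (n + 1)).eval s * gaussWeight s) := by
          congr 1; funext s; rw [eval_mul]; ring
      _ = ∫ s, (derivative P).eval s * ((physHermite n).eval s * gaussWeight s) := h
      _ = ∫ s, (physHermite n * derivative P).eval s * gaussWeight s := by
          congr 1; funext s; rw [eval_mul]; ring
  · have h1 : HasDerivAt gaussWeight (-(2 * s) * gaussWeight s) s := by
      refine ((hasDerivAt_pow 2 s).fun_neg).exp.congr_deriv ?_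
      simp only [gaussWeight, Nat.cast_ofNat, Nat.add_one_sub_one, pow_one]
      ring
    refine (((physHermite n).hasDerivAt s).fun_mul h1).congr_deriv ?_
    rw [physHermite_succ]
    simp only [eval_sub, eval_mul, eval_X, eval_ofNat]
    ring
  · refine (integrable_eval_gauss (-(P * physHermite (n + 1)))).congr
      (Eventually.of_forall fun s => ?_)
    simp only [eval_neg, eval_mul, Pi.mul_apply]; ring
  · refine (integrable_eval_gauss (derivative P * physHermite n)).congr
      (Eventually.of_forall fun s => ?_)
    simp only [eval_mul, Pi.mul_apply]; ring
  · refine (integrable_eval_gauss (P * physHermite n)).congr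
      (Eventually.of_forall fun s => ?_)
    simp only [eval_mul, Pi.mul_apply]; ring

/-- Each integration by parts moves one derivative onto `Q`, and `n` derivatives annihilate a
polynomial of degree less than `n`. -/
theorem isOrthogonalIn_physHermite (n : ℕ) :
    IsOrthogonalIn (weightFunctional Set.univ gaussWeight) ⊤ n (physHermite n) := by
  refine ⟨Submodule.mem_top, (physHermite_degree n).1, fun Q _ hQ => ?_⟩
  induction n generalizing Q with
  | zero =>
    rw [show Q = 0 by simpa using hQ, mul_zero, map_zero]
  | succ n ih =>
    rw [weightFunctional_physHermite_succ]
    refine ih _ Submodule.mem_top ?_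
    rw [degree_lt_iff_coeff_zero] at hQ ⊢
    intro k hk
    rw [coeff_derivative, hQ (k + 1) (by omega), zero_mul]

theorem physHermite_zeros (n : ℕ) :
    physHermite n ≠ 0 ∧ (physHermite n).natDegree ≤ n ∧
      ∃ z : Fin n → ℝ, StrictMono z ∧ ∀ i, (physHermite n).IsRoot (z i) := by
  obtain ⟨h1, h2⟩ := physHermite_degree n
  exact ⟨fun h => h2 (by rw [h, coeff_zero]), natDegree_le_of_degree_lt_succ h1,
    (isOrthogonalIn_physHermite n).zeros_top Set.ordConnected_univ
      (fun _ => isPolyWeight_gauss.weightFunctional_pos) h2⟩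

theorem exists_gramSchmidtPoly_eq_smul_physHermite (n : ℕ) :
    ∃ c : ℝ, c ≠ 0 ∧ gramSchmidtPoly (functionalForm (weightFunctional Set.univ gaussWeight))
      (fun j => X ^ j) n = c • physHermite n := by
  have hd : ∀ j, ((X : ℝ[X]) ^ j).degree < (j + 0 + 1 : ℕ) := fun j => by
    rw [degree_X_pow]; exact_mod_cast j.lt_succ_self
  have h1 := isOrthogonalIn_gramSchmidtPoly (W := ⊤) (d := 0) (u := fun j => (X : ℝ[X]) ^ j)
    isPolyWeight_gauss.weightFunctional_mul_self_pos (fun _ => Submodule.mem_top)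
    (fun Q _ hQ => by simpa using hQ) hd (fun j => by simp) n
  refine ⟨_, ?_, h1.eq_smul isPolyWeight_gauss.weightFunctional_mul_self_pos
    (isOrthogonalIn_physHermite n) (physHermite_degree n).2⟩
  refine div_ne_zero ?_ (physHermite_degree n).2
  have := gramSchmidtPoly_coeff (fun j => (X : ℝ[X]) ^ j)
    (functionalForm (weightFunctional Set.univ gaussWeight)) 0 hd n
  rw [add_zero, coeff_X_pow_self] at this
  rw [add_zero, this]
  exact one_ne_zero

/-- The `X₁`-Laguerre weight with `α = N² / 2` in the variable `s = (x - α) / N`, up to a constant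
factor. -/
noncomputable def scaledLaguerreWeight (N s : ℝ) : ℝ :=
  Real.exp (N ^ 2 / 2 * Real.log (1 + 2 * s / N) - N * s) / (1 + s / N) ^ 2

/-- With `r = √(1 + y)`, `log (1 + y) = 2 log r ≤ 2 (r - 1) = y - (r - 1)²`, and `(r - 1)² = y² / (r
+ 1)²` with `(r + 1)² ≤ 2 (r² + 1) = 2 (2 + y)`. -/
theorem log_one_add_le {y : ℝ} (hy : -1 < y) :
    Real.log (1 + y) ≤ y - y ^ 2 / (2 * (2 + y)) := by
  have h0 : 0 < 1 + y := by linarith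
  set r := √(1 + y) with hr
  have hr0 : 0 < r := Real.sqrt_pos.2 h0
  have hy' : y = r ^ 2 - 1 := by rw [hr, Real.sq_sqrt h0.le]; ring
  have h1 : Real.log (1 + y) = 2 * Real.log r := by
    rw [hr, Real.log_sqrt h0.le]; ring
  have h2 := Real.log_le_sub_one_of_pos hr0
  have h3 : y ^ 2 / (2 * (2 + y)) ≤ (r - 1) ^ 2 := by
    rw [div_le_iff₀ (by linarith), hy']
    nlinarith [mul_nonneg (sq_nonneg (r - 1)) (sq_nonneg (r - 1))]
  nlinarith

theorem one_add_pos_of_mem {N s : ℝ} (hN : 0 < N) (hs : s ∈ Set.Ioi (-(N / 2))) :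
    0 < 1 + 2 * s / N ∧ 1 / 2 < 1 + s / N := by
  have hs : -(N / 2) < s := hs
  have h1 : -1 < 2 * s / N := by rw [lt_div_iff₀ hN]; linarith
  have h2 : 2 * s / N = 2 * (s / N) := by ring
  constructor <;> linarith

theorem scaledLaguerreWeight_pos {N s : ℝ} (hN : 0 < N) (hs : s ∈ Set.Ioi (-(N / 2))) :
    0 < scaledLaguerreWeight N s := by
  have := (one_add_pos_of_mem hN hs).2
  have : 0 < 1 + s / N := by linarith
  unfold scaledLaguerreWeight
  positivity

/-- At `y = 2s/N` the logarithm bound makes the exponent at most `-s² / (2 + 2s/N)`. For `N ≥ 1`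
this is at most `-s² / (2 + 2|s|) ≤ (1 - |s|) / 2`. The 4 comes from `1 + s/N > 1/2`. -/
theorem scaledLaguerreWeight_le {N s : ℝ} (hN : 1 ≤ N) (hs : s ∈ Set.Ioi (-(N / 2))) :
    scaledLaguerreWeight N s ≤ 4 * Real.exp ((1 - |s|) / 2) := by
  have hN0 : 0 < N := by linarith
  obtain ⟨h1, h2⟩ := one_add_pos_of_mem hN0 hs
  have h3 := log_one_add_le (y := 2 * s / N) (by linarith)
  have h4 : N ^ 2 / 2 * Real.log (1 + 2 * s / N) - N * s ≤ (1 - |s|) / 2 := by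
    have h5 : N ^ 2 / 2 * ((2 * s / N) ^ 2 / (2 * (2 + 2 * s / N))) = s ^ 2 / (2 + 2 * s / N) := by
      have : 2 + 2 * s / N ≠ 0 := by linarith
      field_simp
    have h6 : N ^ 2 / 2 * (2 * s / N) = N * s := by field_simp
    have h7 : 2 + 2 * s / N ≤ 2 + 2 * |s| := by
      have : s / N ≤ |s| := (div_le_div_of_nonneg_right (le_abs_self s) hN0.le).trans
        (div_le_self (abs_nonneg s) hN)
      have e : 2 * s / N = 2 * (s / N) := by ring
      linarith
    have h8 : (|s| - 1) / 2 ≤ s ^ 2 / (2 + 2 * s / N) := by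
      calc (|s| - 1) / 2 ≤ s ^ 2 / (2 + 2 * |s|) := by
            rw [le_div_iff₀ (by positivity), ← sq_abs s]; nlinarith
        _ ≤ _ := div_le_div_of_nonneg_left (sq_nonneg s) (by linarith) h7
    have h9 := mul_le_mul_of_nonneg_left h3 (by positivity : 0 ≤ N ^ 2 / 2)
    rw [mul_sub, h5, h6] at h9
    linarith
  unfold scaledLaguerreWeight
  rw [div_le_iff₀ (by positivity)]
  have h10 : 1 ≤ 4 * (1 + s / N) ^ 2 := by nlinarith
  have h11 := Real.exp_le_exp.2 h4
  have h12 := Real.exp_pos ((1 - |s|) / 2)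
  nlinarith

theorem continuousOn_scaledLaguerreWeight {N : ℝ} (hN : 0 < N) :
    ContinuousOn (scaledLaguerreWeight N) (Set.Ioi (-(N / 2))) := by
  intro s hs
  refine ContinuousAt.continuousWithinAt ?_
  obtain ⟨h1, h2⟩ := one_add_pos_of_mem hN hs
  have h3 : 1 + 2 * s / N ≠ 0 := h1.ne'
  have h4 : (1 + s / N) ^ 2 ≠ 0 := pow_ne_zero 2 (by linarith)
  unfold scaledLaguerreWeight
  fun_prop (disch := assumption)

theorem integrable_abs_pow_mul_exp_neg_abs (k : ℕ) :
    Integrable fun s : ℝ => |s| ^ k * (4 * Real.exp ((1 - |s|) / 2)) := by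
  have hpow : ∀ (n : ℕ) (t : ℝ), 0 ≤ t → t ^ n * Real.exp (-(t / 2)) ≤ 2 ^ n * n.factorial := by
    intro n t ht
    have h := Real.pow_div_factorial_le_exp (t / 2) (by positivity) n
    rw [div_le_iff₀ (by positivity), div_pow, div_le_iff₀ (by positivity)] at h
    rw [Real.exp_neg, ← div_eq_mul_inv, div_le_iff₀ (Real.exp_pos _)]
    linarith
  -- The bound `hpow` with exponents `k` and `k + 2` controls the function times `1 + s²`.
  refine (integrable_inv_one_add_sq.const_mul (4 * Real.exp (1 / 2) *
    (2 ^ k * k.factorial + 2 ^ (k + 2) * (k + 2).factorial))).mono'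
    (by fun_prop) (Eventually.of_forall fun s => ?_)
  rw [Real.norm_of_nonneg (by positivity), ← div_eq_mul_inv, le_div_iff₀ (by positivity),
    show (1 - |s|) / 2 = 1 / 2 + -(|s| / 2) by ring, Real.exp_add, ← sq_abs s]
  have h1 := hpow k _ (abs_nonneg s)
  have h2 := hpow (k + 2) _ (abs_nonneg s)
  calc |s| ^ k * (4 * (Real.exp (1 / 2) * Real.exp (-(|s| / 2)))) * (1 + |s| ^ 2)
      = 4 * Real.exp (1 / 2) * (|s| ^ k * Real.exp (-(|s| / 2)) +
          |s| ^ (k + 2) * Real.exp (-(|s| / 2))) := by ring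
    _ ≤ _ := mul_le_mul_of_nonneg_left (add_le_add h1 h2) (by positivity)

theorem isPolyWeight_scaledLaguerre {N : ℝ} (hN : 1 ≤ N) :
    IsPolyWeight (Set.Ioi (-(N / 2))) (scaledLaguerreWeight N) where
  isOpen := isOpen_Ioi
  ordConnected := Set.ordConnected_Ioi
  nonempty := Set.nonempty_Ioi
  pos s hs := scaledLaguerreWeight_pos (by linarith) hs
  integrable k := by
    refine (integrable_abs_pow_mul_exp_neg_abs k).integrableOn.mono'
      (ContinuousOn.aestronglyMeasurable ((continuousOn_id.pow k).mul
        (continuousOn_scaledLaguerreWeight (by linarith))) measurableSet_Ioi)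
      ((ae_restrict_iff' measurableSet_Ioi).2 (Eventually.of_forall fun s hs => ?_))
    rw [norm_mul, norm_pow, Real.norm_eq_abs,
      Real.norm_of_nonneg (scaledLaguerreWeight_pos (by linarith) hs).le]
    exact mul_le_mul_of_nonneg_left (scaledLaguerreWeight_le hN hs) (by positivity)

/-- Second-order expansion of the logarithm at `2s/N`: the linear term cancels `N s`, the quadratic
one gives `-s²`, and the cubic remainder contributes at most `8 |s|³ / N`. -/
theorem tendsto_scaledLaguerreWeight (s : ℝ) :
    Tendsto (fun N => scaledLaguerreWeight N s) atTop (𝓝 (gaussWeight s)) := by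
  have h0 : Tendsto (fun N : ℝ => s / N) atTop (𝓝 0) := tendsto_const_nhds.div_atTop tendsto_id
  have h1 : Tendsto (fun N : ℝ => N ^ 2 / 2 * Real.log (1 + 2 * s / N) - N * s) atTop
      (𝓝 (-s ^ 2)) := by
    rw [tendsto_iff_norm_sub_tendsto_zero]
    have h2 : Tendsto (fun N : ℝ => 8 * |s| ^ 2 * |s / N|) atTop (𝓝 0) := by
      have h := (h0.abs).const_mul (8 * |s| ^ 2)
      rwa [abs_zero, mul_zero] at h
    refine squeeze_zero' (Eventually.of_forall fun _ => norm_nonneg _) ?_ h2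
    filter_upwards [eventually_gt_atTop 0, eventually_gt_atTop (4 * |s|)] with N hN hNs
    have h3 : |-(2 * s / N)| ≤ 1 / 2 := by
      rw [abs_neg, abs_div, abs_mul, abs_two, abs_of_pos hN, div_le_iff₀ hN]; linarith
    have h4 := Real.abs_log_sub_add_sum_range_le (x := -(2 * s / N)) (by linarith) 2
    have h5 : |-(2 * s / N)| ^ 3 / (1 - |-(2 * s / N)|) ≤ 2 * |-(2 * s / N)| ^ 3 := by
      rw [div_le_iff₀ (by linarith)]
      nlinarith [pow_nonneg (abs_nonneg (-(2 * s / N))) 3]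
    have h6 : N ^ 2 / 2 * Real.log (1 + 2 * s / N) - N * s - -s ^ 2 = N ^ 2 / 2 *
        (∑ i ∈ Finset.range 2, (-(2 * s / N)) ^ (i + 1) / (i + 1) +
          Real.log (1 - -(2 * s / N))) := by
      rw [sub_neg_eq_add 1, Finset.sum_range_succ, Finset.sum_range_one]
      simp only [Nat.cast_zero, Nat.cast_one]
      have hq : s = N * (s / N) := by field_simp
      rw [mul_div_assoc]
      generalize Real.log (1 + 2 * (s / N)) = ℓ
      generalize s / N = q at hq
      linear_combination (-N + s + N * q) * hq
    rw [h6, Real.norm_eq_abs, abs_mul, abs_of_pos (by positivity)]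
    refine (mul_le_mul_of_nonneg_left (h4.trans h5) (by positivity)).trans_eq ?_
    rw [abs_neg, abs_div, abs_mul, abs_two, abs_div, abs_of_pos hN]
    field_simp
    ring
  have h2 : Tendsto (fun N : ℝ => (1 + s / N) ^ 2) atTop (𝓝 1) := by
    simpa using (h0.const_add 1).pow 2
  have h3 := ((Real.continuous_exp.tendsto _).comp h1).div h2 one_ne_zero
  rw [div_one] at h3
  exact h3

theorem tendsto_moment_scaledLaguerre (k : ℕ) :
    Tendsto (fun N => ∫ s in Set.Ioi (-(N / 2)), s ^ k * scaledLaguerreWeight N s) atTop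
      (𝓝 (∫ s in Set.univ, s ^ k * gaussWeight s)) := by
  simp only [← integral_indicator measurableSet_Ioi, setIntegral_univ]
  refine tendsto_integral_filter_of_dominated_convergence
    (fun s => |s| ^ k * (4 * Real.exp ((1 - |s|) / 2))) ?_ ?_
    (integrable_abs_pow_mul_exp_neg_abs k) ?_
  · filter_upwards [eventually_ge_atTop 1] with N hN
    rw [aestronglyMeasurable_indicator_iff measurableSet_Ioi]
    exact ((isPolyWeight_scaledLaguerre hN).integrable k).1
  · filter_upwards [eventually_ge_atTop 1] with N hN
    refine Eventually.of_forall fun s => ?_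
    by_cases hs : s ∈ Set.Ioi (-(N / 2))
    · rw [Set.indicator_of_mem hs, norm_mul, norm_pow, Real.norm_eq_abs,
        Real.norm_of_nonneg (scaledLaguerreWeight_pos (by linarith) hs).le]
      exact mul_le_mul_of_nonneg_left (scaledLaguerreWeight_le hN hs) (by positivity)
    · rw [Set.indicator_of_notMem hs, norm_zero]
      positivity
  · refine Eventually.of_forall fun s => ?_
    refine ((tendsto_scaledLaguerreWeight s).const_mul (s ^ k)).congr' ?_
    filter_upwards [eventually_gt_atTop (-(2 * s))] with N hN
    rw [Set.indicator_of_mem (Set.mem_Ioi.2 (show -(N / 2) < s by linarith))]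

theorem exists_laguerreInner_eq {N : ℝ} (hN : 1 ≤ N) :
    ∃ K : ℝ, K ≠ 0 ∧ ∀ P Q, laguerreInner (N ^ 2 / 2) P Q = K * functionalForm
      (weightFunctional (Set.Ioi (-(N / 2))) (scaledLaguerreWeight N))
      (P.comp (C N * X + C (N ^ 2 / 2))) (Q.comp (C N * X + C (N ^ 2 / 2))) := by
  have hN0 : 0 < N := by linarith
  have hpos1 := Real.rpow_pos_of_pos (show 0 < N ^ 2 / 2 by positivity) (N ^ 2 / 2)
  have hpos2 := Real.exp_pos (-(N ^ 2 / 2))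
  -- With `x = N s + N²/2`: `N` from `dx`, then the constant parts of `e^{-x}` and `x^α`, and `N⁴`
  -- from `x + α = N² (1 + s/N)`.
  refine ⟨N * (Real.exp (-(N ^ 2 / 2)) * (N ^ 2 / 2) ^ (N ^ 2 / 2)) / N ^ 4, by positivity,
    fun P Q => ?_⟩
  refine setIntegral_eq_functionalForm (isPolyWeight_scaledLaguerre hN) hN0.ne'
    (fun x => ?_) (fun s hs => ?_) P Q
  · have e : N * x + N ^ 2 / 2 = N * (x + N / 2) := by ring
    rw [Set.mem_Ioi, Set.mem_Ioi, e, mul_pos_iff_of_pos_left hN0]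
    constructor <;> intro h <;> linarith
  · obtain ⟨h1, h2⟩ := one_add_pos_of_mem hN0 hs
    have h3 : 1 + s / N ≠ 0 := by linarith
    have e1 : N * s + N ^ 2 / 2 = N ^ 2 / 2 * (1 + 2 * s / N) := by field_simp; ring
    have e2 : N * s + N ^ 2 / 2 + N ^ 2 / 2 = N ^ 2 * (1 + s / N) := by field_simp; ring
    have e3 : Real.exp (-(N * s + N ^ 2 / 2)) = Real.exp (-(N ^ 2 / 2)) * Real.exp (-(N * s)) := by
      rw [← Real.exp_add]; congr 1; ring
    have e4 : Real.exp (N ^ 2 / 2 * Real.log (1 + 2 * s / N) - N * s) =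
        (1 + 2 * s / N) ^ (N ^ 2 / 2) * Real.exp (-(N * s)) := by
      rw [sub_eq_add_neg, Real.exp_add, Real.rpow_def_of_pos h1, mul_comm (N ^ 2 / 2)]
    rw [e2, e3, e1, Real.mul_rpow (by positivity) h1.le, abs_of_pos hN0, scaledLaguerreWeight, e4]
    generalize (1 + 2 * s / N) ^ (N ^ 2 / 2) = A
    generalize (N ^ 2 / 2) ^ (N ^ 2 / 2) = B
    generalize 1 + s / N = D at *
    field_simp

theorem x1Laguerre_comp {N : ℝ} (hN : 1 ≤ N) (m : ℕ) :
    (x1Laguerre (N ^ 2 / 2) (m + 1)).comp (C N * X + C (N ^ 2 / 2)) =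
      N ^ (m + 1) • gramSchmidtPoly
        (functionalForm (weightFunctional (Set.Ioi (-(N / 2))) (scaledLaguerreWeight N)))
        (robinSeq N (1 / N)) m := by
  obtain ⟨K, hK, hB⟩ := exists_laguerreInner_eq hN
  have hN0 : N ≠ 0 := by linarith
  rw [x1Laguerre, Nat.add_sub_cancel, laguerreSeq_eq]
  refine gramSchmidtPoly_comp (c := fun j => N ^ (j + 1)) hK
    (fun j => pow_ne_zero _ hN0) hB functionalForm_smul_smul (fun j => ?_) m
  have key : ∀ r e : ℝ, N ^ 2 / 2 + r = N * e →
      (X + C r).comp (C N * X + C (N ^ 2 / 2)) = C N * (X + C e) := by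
    intro r e h
    rw [add_comp, X_comp, C_comp, mul_add, ← C_mul, ← h, C_add]
    ring
  cases j with
  | zero =>
    rw [robinSeq, robinSeq, key _ (N + 1 / N), smul_eq_C_mul]
    · simp
    · field_simp; ring
  | succ j =>
    rw [robinSeq, robinSeq, pow_comp, key _ N, smul_eq_C_mul, mul_pow, C_pow]
    · ring

/-- The coefficient `c` for which `x ^ j (1 + c x)` satisfies `N⁻¹ P'(-N) = P(-N)`. -/
noncomputable def robinCoeff (N : ℝ) (j : ℕ) : ℝ := (N ^ 2 + j) / (N ^ 3 + (j + 1) * N)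

/-- A basis of the space `N⁻¹ P'(-N) = P(-N)` that converges to the monomials as `N → ∞`. -/
noncomputable def robinMonomial (N : ℝ) (j : ℕ) : ℝ[X] := X ^ j + C (robinCoeff N j) * X ^ (j + 1)

theorem robinMonomial_mem {N : ℝ} (hN : 0 < N) (j : ℕ) :
    robinMonomial N j ∈ robinSubmodule N (1 / N) := by
  rw [mem_robinSubmodule, robinMonomial]
  have hden : N ^ 3 + (j + 1) * N ≠ 0 := by positivity
  have hc : robinCoeff N j * (N ^ 3 + (j + 1) * N) = N ^ 2 + j := div_mul_cancel₀ _ hden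
  generalize robinCoeff N j = c at *
  cases j with
  | zero =>
    have hc' : c * (N ^ 2 + 1) = N := by
      refine mul_left_cancel₀ hN.ne' ?_
      rw [Nat.cast_zero] at hc
      linear_combination hc
    simp only [zero_add, pow_zero, pow_one, derivative_add, derivative_one, derivative_C_mul,
      derivative_X, mul_one, eval_C, eval_add, eval_one, eval_mul, eval_X]
    field_simp
    linear_combination hc'
  | succ j =>
    rw [one_div, inv_mul_eq_iff_eq_mul₀ hN.ne']
    simp only [derivative_add, derivative_C_mul, derivative_X_pow, eval_add, eval_mul, eval_C,
      eval_pow, eval_X, Nat.add_sub_cancel]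
    push_cast at hc ⊢
    simp only [pow_succ]
    linear_combination (-(-N) ^ j) * hc

theorem natDegree_robinMonomial_le (N : ℝ) (j : ℕ) : (robinMonomial N j).natDegree ≤ j + 1 := by
  unfold robinMonomial
  compute_degree

theorem coeff_robinMonomial (N : ℝ) (j : ℕ) : (robinMonomial N j).coeff (j + 1) = robinCoeff N j := by
  simp [robinMonomial, coeff_X_pow]

theorem tendsto_robinCoeff (j : ℕ) : Tendsto (fun N => robinCoeff N j) atTop (𝓝 0) := by
  refine squeeze_zero' (g := fun N => (1 + j) / N) ?_ ?_
    (tendsto_const_nhds.div_atTop tendsto_id)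
  · filter_upwards [eventually_ge_atTop 1] with N hN
    unfold robinCoeff
    positivity
  · filter_upwards [eventually_ge_atTop 1] with N hN
    rw [robinCoeff, div_le_div_iff₀ (by positivity) (by positivity)]
    have hj : (0 : ℝ) ≤ j := Nat.cast_nonneg j
    have h1 : (j : ℝ) * N ≤ j * N ^ 3 :=
      mul_le_mul_of_nonneg_left (le_self_pow₀ hN three_ne_zero) hj
    nlinarith [mul_nonneg (mul_nonneg hj hj) (by linarith : 0 ≤ N)]

theorem polyTendsto_robinMonomial (j : ℕ) :
    PolyTendsto (fun N => robinMonomial N j) atTop (X ^ j) := by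
  have := (polyTendsto_const (l := (atTop : Filter ℝ)) ((X : ℝ[X]) ^ j)).add
    ((polyTendsto_C (tendsto_robinCoeff j)).mul (polyTendsto_const (X ^ (j + 1))))
  simpa [robinMonomial] using this

/-- Both bases yield the orthogonal element of degree `m + 1` in the same space, so the divergent
basis can be traded for the convergent one. -/
theorem exists_x1Laguerre_comp_eq {N : ℝ} (hN : 1 ≤ N) (m : ℕ) :
    ∃ c : ℝ, (x1Laguerre (N ^ 2 / 2) (m + 1)).comp (C N * X + C (N ^ 2 / 2)) =
      c • gramSchmidtPoly
        (functionalForm (weightFunctional (Set.Ioi (-(N / 2))) (scaledLaguerreWeight N)))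
        (robinMonomial N) m := by
  have hN0 : 0 < N := by linarith
  have h := isPolyWeight_scaledLaguerre hN
  obtain ⟨h1, h2⟩ := isOrthogonalIn_robinSeq h N (1 / N) m
  obtain ⟨h3, h4⟩ := isOrthogonalIn_gramSchmidtPoly_robin h (robinMonomial_mem hN0)
    (natDegree_robinMonomial_le N) (fun j => by
      rw [coeff_robinMonomial, robinCoeff]; positivity) m
  rw [x1Laguerre_comp hN, h1.eq_smul h.weightFunctional_mul_self_pos h3 h4, smul_smul]
  exact ⟨_, rfl⟩

theorem tendsto_scaled_orderedZero_x1Laguerre {m : ℕ} (i : Fin m) :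
    Tendsto (fun N : ℝ => (orderedZero (x1Laguerre (N ^ 2 / 2) (m + 1)) (i + 2) - N ^ 2 / 2) / N)
      atTop (𝓝 (orderedZero (physHermite m) (i + 1))) := by
  obtain ⟨hne, hdeg, z, hz, hzr⟩ := physHermite_zeros m
  rw [(orderedZero_eq hne hdeg hz hzr).2, Metric.tendsto_nhds]
  intro ε hε
  obtain ⟨c, hc, hcq⟩ := exists_gramSchmidtPoly_eq_smul_physHermite m
  have hG := isPolyWeight_gauss
  have hp := polyTendsto_gramSchmidtPoly (l := atTop)
    (F := fun N => weightFunctional (Set.Ioi (-(N / 2))) (scaledLaguerreWeight N))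
    (G := weightFunctional Set.univ gaussWeight)
    (u := robinMonomial) (v := fun j => X ^ j)
    (fun k => by simpa only [weightFunctional_X_pow] using tendsto_moment_scaledLaguerre k)
    polyTendsto_robinMonomial
    (fun j => (hG.weightFunctional_mul_self_pos _ fun h => by
      obtain ⟨c, hc, hcq⟩ := exists_gramSchmidtPoly_eq_smul_physHermite j
      rw [hcq] at h
      exact (smul_ne_zero hc (physHermite_zeros j).1) h).ne') m
  rw [hcq] at hp
  have hev := tendsto_zeros_of_eval (smul_ne_zero hc hne) ((natDegree_smul_le _ _).trans hdeg) hz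
    (fun i => by rw [IsRoot, eval_smul, (hzr i).eq_zero, smul_zero]) hp.eval hε
  -- This keeps the zeros near the Hermite zeros above `-N`, that is above `-α` in the variable `x`,
  -- hence to the right of the exceptional zero.
  have hbd : ∀ᶠ N : ℝ in atTop, ∀ j, -N < z j - ε :=
    eventually_all.2 fun j => by
      filter_upwards [eventually_gt_atTop (-(z j - ε))] with N hN
      linarith
  filter_upwards [hev, hbd, eventually_ge_atTop 1] with N ⟨y, hy, hyr, hyz⟩ hN hN1
  have hN0 : 0 < N := by linarith
  obtain ⟨hne', hdeg', x, -, hxr, hx0⟩ := x1Laguerre_zeros (α := N ^ 2 / 2) (by positivity) m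
  obtain ⟨c', hc'⟩ := exists_x1Laguerre_comp_eq hN1 m
  -- The exceptional zero followed by the `m` transported zeros gives `m + 1` distinct zeros, hence
  -- all of them, in increasing order.
  have hmono : StrictMono (Fin.cons (x 0) (fun j => N * y j + N ^ 2 / 2) : Fin (m + 1) → ℝ) := by
    refine strictMono_fin_cons (fun a b hab => ?_) fun j => ?_
    · have := mul_lt_mul_of_pos_left (hy hab) hN0
      change N * y a + N ^ 2 / 2 < N * y b + N ^ 2 / 2
      linarith
    · have h1 := (abs_lt.1 (hyz j)).1
      have h2 : -N < y j := by linarith [hN j]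
      nlinarith
  have hroot : ∀ a, (x1Laguerre (N ^ 2 / 2) (m + 1)).IsRoot
      ((Fin.cons (x 0) (fun j => N * y j + N ^ 2 / 2) : Fin (m + 1) → ℝ) a) := by
    intro a
    refine Fin.cases ?_ (fun j => ?_) a
    · exact hxr 0
    · have e := congrArg (eval (y j)) hc'
      rw [eval_comp, eval_smul, (hyr j).eq_zero, smul_zero] at e
      rw [Fin.cons_succ, IsRoot, ← e]
      simp
  have hzero := (orderedZero_eq hne' hdeg' hmono hroot).2 i.succ
  rw [Fin.cons_succ, Fin.val_succ, add_assoc] at hzero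
  rw [hzero, add_sub_cancel_right, mul_div_cancel_left₀ _ hN0.ne', Real.dist_eq]
  exact hyz i

end LaguerreHermite

theorem theorem3 (n k : ℕ) (hk : 1 ≤ k) (hkn : k ≤ n) :
    (∀ α : ℝ, 0 < α →
      (∀ β : ℝ, α < β → HasSimpleRealZeros (x1Jacobi α β n) n) ∧
      HasSimpleRealZeros (x1Laguerre α n) n ∧
      Tendsto (fun β : ℝ => β * (1 - orderedZero (x1Jacobi α β n) k) / 2) atTop
        (𝓝 (orderedZero (x1Laguerre α n) (n + 1 - k)))) ∧
    (2 ≤ k →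
      HasSimpleRealZeros (physHermite (n - 1)) (n - 1) ∧
      Tendsto (fun α : ℝ => (orderedZero (x1Laguerre α n) k - α) / √(2 * α)) atTop
        (𝓝 (orderedZero (physHermite (n - 1)) (k - 1)))) := by
  obtain ⟨m, rfl⟩ : ∃ m, n = m + 1 := ⟨n - 1, by omega⟩
  refine ⟨fun α hα => ⟨fun β hβ => hasSimpleRealZeros_x1Jacobi hα hβ m, ?_, ?_⟩, fun hk2 => ⟨?_, ?_⟩⟩
  · obtain ⟨hne, hdeg, z, hz, hzr, -⟩ := x1Laguerre_zeros hα m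
    exact (orderedZero_eq hne hdeg hz hzr).1
  · have h := tendsto_orderedZero_x1Jacobi hα (⟨k - 1, by omega⟩ : Fin (m + 1))
    rw [Fin.val_rev] at h
    simp only at h
    rwa [show k - 1 + 1 = k by omega, show m + 1 - k + 1 = m + 1 + 1 - k by omega] at h
  · obtain ⟨hne, hdeg, z, hz, hzr⟩ := physHermite_zeros m
    exact (orderedZero_eq hne hdeg hz hzr).1
  · have h := tendsto_scaled_orderedZero_x1Laguerre (⟨k - 2, by omega⟩ : Fin m)
    simp only at h
    rw [show k - 2 + 2 = k by omega, show k - 2 + 1 = k - 1 by omega] at h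
    have hlim : Tendsto (fun α : ℝ => √(2 * α)) atTop atTop :=
      Real.tendsto_sqrt_atTop.comp (tendsto_id.const_mul_atTop two_pos)
    refine (h.comp hlim).congr' ?_
    filter_upwards [eventually_ge_atTop 0] with α hα
    have e : √(2 * α) ^ 2 / 2 = α := by
      rw [Real.sq_sqrt (by positivity)]; ring
    simp only [Function.comp_apply, e]
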